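/- An \emph{oriented perfect path double cover} (OPPDC) of a finite simple graph $G$ is a collection of directed paths (paths of length zero allowed) in the symmetric orientation $G_s$, the digraph obtained from $G$ by replacing each edge by two opposite arcs, such that each arc of $G_s$ lies in exactly one of the paths and each vertex of $G$ is the beginning of exactly one of the paths and the end of exactly one of the paths. Let $T$ be a finite tree whose line graph $L(T)$ is isomorphic neither to $K_3$ nor to $K_5$ (equivalently, $T$ is neither the star $K_{1,3}$ nor the star $K_{1,5}$). Then $L(T)$ has an OPPDC. -/

import Mathlib

namespace SimpleGraph

universe u

variable {V : Type u}

/-- A directed path in the symmetric orientation of `G`. The arcs of the symmetric orientation are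
the darts (oriented edges) of `G`, so a directed path is a walk of `G` without repeated vertices,
together with its beginning and its end. Paths of length zero are allowed. -/
structure DirectedPath (G : SimpleGraph V) where
  /-- the vertex where the path begins -/
  start : V
  /-- the vertex where the path ends -/
  finish : V
  /-- the underlying walk, traversed from `start` to `finish` -/
  walk : G.Walk start finish
  /-- no vertex is repeated -/
  isPath : walk.IsPath

/-- `C` is an oriented perfect path double cover (OPPDC) of `G`: every arc of the symmetric
orientation of `G` lies in exactly one path of `C`, and every vertex is the beginning of exactly
one path of `C` and the end of exactly one path of `C`. (Since no two members of such a collection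
begin at the same vertex, nothing is lost by taking a set instead of a multiset.) -/
structure IsOPPDC (G : SimpleGraph V) (C : Set G.DirectedPath) : Prop where
  existsUnique_arc : ∀ d : G.Dart, ∃! P : G.DirectedPath, P ∈ C ∧ d ∈ P.walk.darts
  existsUnique_start : ∀ v : V, ∃! P : G.DirectedPath, P ∈ C ∧ P.start = v
  existsUnique_finish : ∀ v : V, ∃! P : G.DirectedPath, P ∈ C ∧ P.finish = v

/-- `G` has an oriented perfect path double cover. -/
def HasOPPDC (G : SimpleGraph V) : Prop :=
  ∃ C : Set G.DirectedPath, G.IsOPPDC C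

end SimpleGraph

/-! The stars of `T` are cliques of the line graph, and they partition its arcs. When a connected
vertex set of the acyclic `T` grows by a neighbour, the new star meets the edges already covered in
exactly one edge (`starAt_inter_edgesAt`). So it suffices to cover complete digraphs and to glue
covers that share one vertex v.

Put together, covers of A and B have v twice as a beginning and twice as an end. Joining a path of A
ending at v to a path of B beginning at v removes the surplus, and the result has no repeated vertex
because A and B meet only in v (`IsCover.glue`).

For n other than 3 and 5, the complete digraph on n vertices splits into n Hamiltonian paths with
distinct beginnings and distinct ends (`hasPathDecomp_fin`). For even n these are translates of a
zigzag. For odd n, Hamiltonian cycles on n + 1 vertices are built from a decomposition of about half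
the order, and one vertex is deleted; a few small orders are explicit.

Stars of size 3 or 5 instead get a cover in which v begins and ends one path too many
(`hasDoubleCover_offDiag`). It can be glued to a cover in which some arc enters v, and also to
another cover of its own kind. A tree with such a star can therefore be started at a star of size
other than 1, 3, 5, or at two adjacent stars of size 3 or 5; if neither exists, the tree is itself
one of the two excluded stars. -/

namespace PathCover

variable {α β : Type*}

/-! ### Directed paths as lists, and decompositions of complete digraphs. -/

/-- The pairs of consecutive entries of a list. -/
def arcs (l : List α) : List (α × α) := l.zip l.tail

@[simp] lemma arcs_nil : arcs ([] : List α) = [] := rfl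

@[simp] lemma arcs_singleton (a : α) : arcs [a] = [] := rfl

@[simp] lemma arcs_cons_cons (a b : α) (l : List α) :
    arcs (a :: b :: l) = (a, b) :: arcs (b :: l) := rfl

lemma mem_arcs_iff {l : List α} {u v : α} : (u, v) ∈ arcs l ↔ [u, v] <:+: l := by
  induction l with
  | nil => simp
  | cons a l ih =>
    cases l with
    | nil => simp [List.infix_cons_iff]
    | cons b l =>
      rw [arcs_cons_cons, List.mem_cons, ih, List.infix_cons_iff (a := a)]
      simp [List.cons_prefix_cons]

lemma length_arcs (l : List α) : (arcs l).length = l.length - 1 := by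
  simp [arcs]

lemma arcs_map (g : α → β) (l : List α) : arcs (l.map g) = (arcs l).map (Prod.map g g) := by
  simp [arcs, ← List.map_tail, List.zip_map]

lemma arcs_append (s t : List α) (v : α) :
    arcs (s ++ v :: t) = arcs (s ++ [v]) ++ arcs (v :: t) := by
  induction s with
  | nil => simp
  | cons a s ih =>
    cases s with
    | nil => simp
    | cons b s => simpa using ih

/-- A family of directed Hamiltonian paths of the complete graph on `α`, one starting at each
vertex and one ending at each vertex, which covers all arcs. -/
def HasPathDecomp (α : Type*) : Prop :=
  ∃ f : α → List α, (∀ i, (f i).Nodup) ∧ (∀ i x, x ∈ f i) ∧ (∀ i, (f i).head? = some i) ∧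
    (∀ v, ∃ i, (f i).getLast? = some v) ∧ ∀ u v, u ≠ v → ∃ i, [u, v] <:+: f i

lemma HasPathDecomp.congr (e : α ≃ β) (h : HasPathDecomp α) : HasPathDecomp β := by
  obtain ⟨f, h1, h2, h3, h4, h5⟩ := h
  refine ⟨fun i => (f (e.symm i)).map e, fun i => (h1 _).map e.injective, fun i x => ?_,
    fun i => by simp [h3], fun v => ?_, fun u v huv => ?_⟩
  · exact List.mem_map.2 ⟨e.symm x, h2 _ _, by simp⟩
  · obtain ⟨i, hi⟩ := h4 (e.symm v)
    exact ⟨e i, by simp [hi]⟩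
  · obtain ⟨i, hi⟩ := h5 (e.symm u) (e.symm v) (by simpa using huv)
    exact ⟨e i, by simpa using hi.map e⟩

/-- A family of directed Hamiltonian cycles of the complete graph on `α` which covers all arcs and
has one member fewer than `α` has elements. -/
def HasCycleDecomp (α : Type*) : Prop :=
  ∃ (ι : Type) (_ : Finite ι) (f : ι → List α), Nat.card ι + 1 = Nat.card α ∧ (∀ i, (f i).Nodup) ∧
    (∀ i x, x ∈ f i) ∧ ∀ u v, u ≠ v → ∃ i t, f i ~r u :: v :: t

lemma HasCycleDecomp.congr (e : α ≃ β) (h : HasCycleDecomp α) : HasCycleDecomp β := by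
  obtain ⟨ι, hι, f, h0, h1, h2, h5⟩ := h
  refine ⟨ι, hι, fun i => (f i).map e, by rw [h0, Nat.card_congr e], fun i => (h1 _).map e.injective,
    fun i x => ?_, fun u v huv => ?_⟩
  · exact List.mem_map.2 ⟨e.symm x, h2 _ _, by simp⟩
  · obtain ⟨i, t, hi⟩ := h5 (e.symm u) (e.symm v) (by simpa using huv)
    exact ⟨i, t.map e, by simpa using hi.map e⟩

/-- Without repetitions only the trivial rotation keeps the first entry, so a cycle can be read from
a given vertex in only one way. -/
lemma eq_of_isRotated_cons {x : α} {s t : List α} (hs : (x :: s).Nodup)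
    (h : x :: s ~r x :: t) : s = t := by
  obtain ⟨n, hn⟩ := h
  have hlen : 0 < (x :: s).length := by simp
  have h1 : ((x :: s).rotate n)[0]'(by simp) = x := by simp [hn]
  rw [List.getElem_rotate] at h1
  have h2 : (0 + n) % (x :: s).length = 0 := by
    have := (hs.getElem_inj_iff (i := (0 + n) % (x :: s).length)
      (hi := Nat.mod_lt _ hlen) (j := 0) (hj := hlen)).1 (by simpa using h1)
    exact this
  rw [← List.rotate_mod, show n % (x :: s).length = 0 by simpa using h2] at hn
  simpa using hn

/-- Deleting a vertex turns a decomposition into Hamiltonian cycles into one into paths. -/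
lemma HasCycleDecomp.hasPathDecomp [Finite α] (h : HasCycleDecomp (Option α)) :
    HasPathDecomp α := by
  classical
  obtain ⟨ι, hι, f, h0, h1, h2, h5⟩ := h
  -- Read each cycle from `none`: the rest is the path that remains when `none` is deleted.
  have key : ∀ i, ∃ t : List α, f i ~r none :: t.map some := by
    intro i
    obtain ⟨s, t, hst⟩ := List.append_of_mem (h2 i none)
    have hr : f i ~r none :: (t ++ s) := by
      rw [hst]; simpa using List.isRotated_append (l := s) (l' := none :: t)
    have hnd : (none :: (t ++ s)).Nodup := hr.nodup_iff.1 (h1 i)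
    have hnn : none ∉ t ++ s := (List.nodup_cons.1 hnd).1
    refine ⟨(t ++ s).reduceOption, hr.trans ?_⟩
    rw [show ((t ++ s).reduceOption).map some = t ++ s from ?_]
    generalize t ++ s = r at hnn
    clear * - hnn
    induction r with
    | nil => simp
    | cons a r ih =>
      cases a with
      | none => simp at hnn
      | some a => simpa using ih (by simpa using hnn)
  choose g hg using key
  have hnd : ∀ i, (none :: (g i).map some).Nodup := fun i => (hg i).nodup_iff.1 (h1 i)
  have hgn : ∀ i, (g i).Nodup := fun i => ((List.nodup_cons.1 (hnd i)).2).of_map _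
  have hgm : ∀ i x, x ∈ g i := fun i x => by
    have := (hg i).mem_iff.1 (h2 i (some x))
    simpa using this
  have hhead : ∀ v, ∃ i, (g i).head? = some v := fun v => by
    obtain ⟨i, t, hi⟩ := h5 none (some v) (by simp)
    have := eq_of_isRotated_cons (hnd i) ((hg i).symm.trans hi)
    refine ⟨i, ?_⟩
    have h := congrArg List.head? this
    simpa using h
  have hlast : ∀ v, ∃ i, (g i).getLast? = some v := fun v => by
    obtain ⟨i, t, hi⟩ := h5 (some v) none (by simp)
    have hi' : f i ~r none :: (t ++ [some v]) :=
      hi.trans (by simpa using List.isRotated_append (l := [some v]) (l' := none :: t))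
    have := eq_of_isRotated_cons (hnd i) ((hg i).symm.trans hi')
    refine ⟨i, ?_⟩
    have h := congrArg List.getLast? this
    simpa using h
  have harc : ∀ u v, u ≠ v → ∃ i, [u, v] <:+: g i := fun u v huv => by
    obtain ⟨i, t, hi⟩ := h5 (some u) (some v) (by simpa using huv)
    have hmem : none ∈ t := by simpa using hi.mem_iff.1 (h2 i none)
    obtain ⟨a, b, rfl⟩ := List.append_of_mem hmem
    have hi' : f i ~r none :: (b ++ some u :: some v :: a) :=
      hi.trans (by simpa using List.isRotated_append (l := some u :: some v :: a) (l' := none :: b))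
    have := eq_of_isRotated_cons (hnd i) ((hg i).symm.trans hi')
    refine ⟨i, ?_⟩
    have h3 : [some u, some v] <:+: (g i).map some := by
      rw [this]; exact ⟨b, a, by simp⟩
    rw [← mem_arcs_iff, arcs_map] at h3
    rw [← mem_arcs_iff]
    simpa using h3
  have hcard : Nat.card ι = Nat.card α := by
    have : Nat.card (Option α) = Nat.card α + 1 := Finite.card_option
    omega
  choose k hk using hhead
  have hkinj : Function.Injective k := fun u v huv => by
    have := hk u
    rw [huv, hk v] at this
    simpa using this.symm
  -- There are as many cycles as remaining vertices, so the paths can be indexed by their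
  -- beginnings.
  have hkbij : Function.Bijective k := (Nat.bijective_iff_injective_and_card k).2 ⟨hkinj, hcard.symm⟩
  refine ⟨fun v => g (k v), fun i => hgn _, fun i => hgm _, hk, fun v => ?_, fun u v huv => ?_⟩
  · obtain ⟨i, hi⟩ := hlast v
    obtain ⟨j, rfl⟩ := hkbij.2 i
    exact ⟨j, hi⟩
  · obtain ⟨i, hi⟩ := harc u v huv
    obtain ⟨j, rfl⟩ := hkbij.2 i
    exact ⟨j, hi⟩

/-! ### Counting and rotation of lists. -/

lemma nodup_of_length_eq_card [Finite α] {l : List α} (hl : ∀ x, x ∈ l)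
    (hc : l.length = Nat.card α) : l.Nodup := by
  classical
  have := Fintype.ofFinite α
  have h : l.toFinset = Finset.univ := by ext; simp [hl]
  rw [Nat.card_eq_fintype_card, ← Finset.card_univ, ← h] at hc
  exact (Multiset.toFinset_card_eq_card_iff_nodup (m := (l : Multiset α))).1 hc.symm

lemma length_eq_card [Finite α] {l : List α} (hl : ∀ x, x ∈ l)
    (hc : l.Nodup) : l.length = Nat.card α := by
  classical
  have := Fintype.ofFinite α
  have h : l.toFinset = Finset.univ := by ext; simp [hl]
  rw [Nat.card_eq_fintype_card, ← Finset.card_univ, ← h, List.toFinset_card_of_nodup hc]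

lemma isRotated_flatMap {l l' : List α} (h : l ~r l') (g : α → List β) :
    l.flatMap g ~r l'.flatMap g := by
  obtain ⟨n, hn, rfl⟩ := List.isRotated_iff_mod.1 h
  conv_lhs => rw [← List.take_append_drop n l]
  rw [List.rotate_eq_drop_append_take hn, List.flatMap_append, List.flatMap_append]
  exact List.isRotated_append

lemma range_isRotated {m t : ℕ} (hm : 2 ≤ m) (ht : t < m) :
    ∃ r, List.range m ~r t :: ((t + 1) % m) :: r := by
  rcases Nat.lt_or_ge (t + 1) m with h | h
  · obtain ⟨k, rfl⟩ := Nat.exists_eq_add_of_lt h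
    rw [Nat.mod_eq_of_lt h]
    have : List.range (t + 1 + k + 1) = List.range t ++ (t :: (t + 1) ::
        (List.range k).map (fun x => t + 2 + x)) := by
      rw [show t + 1 + k + 1 = t + (2 + k) by ring, List.range_add]
      congr 1
      rw [List.range_add]
      simp [List.range_succ, Function.comp_def, add_assoc]
    rw [this]
    exact ⟨_, List.isRotated_append.trans (List.IsRotated.refl _)⟩
  · obtain rfl : m = t + 1 := by omega
    obtain ⟨k, rfl⟩ : ∃ k, t = k + 1 := ⟨t - 1, by omega⟩
    rw [Nat.mod_self, List.range_succ, List.range_succ_eq_map]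
    exact ⟨_, List.isRotated_append⟩

/-- The successor is taken modulo `m` because the last block of a cycle is followed by the first. -/
lemma flatMap_range_isRotated (g : ℕ → List β) {m t : ℕ} (hm : 2 ≤ m) (ht : t < m) :
    ∃ r, (List.range m).flatMap g ~r g t ++ (g ((t + 1) % m) ++ r) := by
  obtain ⟨r, hr⟩ := range_isRotated hm ht
  exact ⟨r.flatMap g, by simpa using isRotated_flatMap hr g⟩

/-! ### Even orders: translates of a zigzag. -/

/-- The partial sums of the alternating sequence `1, -2, 3, -4, …`. -/
def zigzag (p : ℕ) : ℤ := if p % 2 = 0 then -((p / 2 : ℕ) : ℤ) else ((p / 2 + 1 : ℕ) : ℤ)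

lemma zigzag_even (q : ℕ) : zigzag (2 * q) = -(q : ℤ) := by
  simp [zigzag]

lemma zigzag_odd (q : ℕ) : zigzag (2 * q + 1) = q + 1 := by
  have : (2 * q + 1) / 2 = q := by omega
  simp [zigzag, this, Nat.add_mod]

lemma infix_map_range (g : ℕ → α) {m p : ℕ} (h : p + 1 < m) :
    [g p, g (p + 1)] <:+: (List.range m).map g := by
  obtain ⟨k, rfl⟩ := Nat.exists_eq_add_of_lt h
  have : List.range (p + 1 + k + 1) = List.range p ++ [p, p + 1] ++
      (List.range k).map (fun x => p + 2 + x) := by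
    rw [show p + 1 + k + 1 = p + 2 + k by ring, List.range_add, List.range_add (n := p)]
    simp [List.range_succ]
  rw [this, List.map_append, List.map_append]
  exact ⟨_, _, rfl⟩

lemma zmod_eq_natCast {n : ℕ} [NeZero n] (x : ZMod n) : ∃ k < n, x = (k : ZMod n) :=
  ⟨x.val, x.val_lt, by simp⟩

lemma exists_two_inverse {m : ℕ} (hm : Odd m) : ∃ r : ZMod m, r * 2 = 1 := by
  obtain ⟨k, hk⟩ := hm
  refine ⟨(k + 1 : ℕ), ?_⟩
  have : ((2 * k + 1 : ℕ) : ZMod m) = 0 := by rw [← hk]; simp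
  push_cast at this ⊢
  linear_combination this

/-- Complete graphs on an even number of vertices: the zigzag paths. -/
lemma hasPathDecomp_even (m : ℕ) [NeZero m] : HasPathDecomp (ZMod (2 * m)) := by
  have hm : 0 < m := Nat.pos_of_ne_zero (NeZero.ne m)
  have hself : ((2 * m : ℕ) : ZMod (2 * m)) = 0 := ZMod.natCast_self _
  push_cast at hself
  have hfull : ∀ i x : ZMod (2 * m),
      x ∈ (List.range (2 * m)).map fun p => i + ((zigzag p : ℤ) : ZMod (2 * m)) := by
    intro i x
    rw [List.mem_map]
    obtain ⟨k, hk, hxk⟩ := zmod_eq_natCast (x - i)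
    -- Residue 0 is at position 0, residues 1 to m are at the odd positions, and the others, as
    -- negatives, at the even ones.
    rcases Nat.eq_zero_or_pos k with rfl | hk0
    · refine ⟨0, by simpa using hm, ?_⟩
      have : x - i = 0 := by simpa using hxk
      simp [zigzag, sub_eq_zero.1 this]
    · rcases Nat.lt_or_ge m k with h | h
      · obtain ⟨q, rfl⟩ : ∃ q, k = 2 * m - q := ⟨2 * m - k, by omega⟩
        refine ⟨2 * q, by simp; omega, ?_⟩
        rw [zigzag_even, eq_comm, ← sub_eq_iff_eq_add', hxk, Nat.cast_sub (by omega)]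
        push_cast
        rw [hself]; ring
      · obtain ⟨q, rfl⟩ : ∃ q, k = q + 1 := ⟨k - 1, by omega⟩
        refine ⟨2 * q + 1, by simp; omega, ?_⟩
        rw [zigzag_odd, eq_comm, ← sub_eq_iff_eq_add', hxk]
        push_cast; ring
  refine ⟨fun i => (List.range (2 * m)).map fun p => i + ((zigzag p : ℤ) : ZMod (2 * m)),
    fun i => nodup_of_length_eq_card (hfull i) (by simp), hfull, fun i => ?_, fun v => ?_,
    fun u v huv => ?_⟩
  · obtain ⟨k, rfl⟩ : ∃ k, m = k + 1 := ⟨m - 1, by omega⟩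
    rw [show List.range (2 * (k + 1)) = _ from List.range_succ_eq_map (n := 2 * k + 1)]
    simp [zigzag]
  · refine ⟨v - (zigzag (2 * m - 1) : ℤ), ?_⟩
    obtain ⟨k, rfl⟩ : ∃ k, m = k + 1 := ⟨m - 1, by omega⟩
    rw [show List.range (2 * (k + 1)) = List.range (2 * k + 1) ++ [2 * k + 1] from List.range_succ]
    simp [show 2 * (k + 1) - 1 = 2 * k + 1 by omega]
  · obtain ⟨k, hk, hxk⟩ := zmod_eq_natCast (v - u)
    -- All translates are available, so only the difference of the arc matters.
    suffices h : ∃ p, p + 1 < 2 * m ∧ (v - u : ZMod (2 * m)) =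
        ((zigzag (p + 1) - zigzag p : ℤ) : ZMod (2 * m)) by
      obtain ⟨p, hp, hpe⟩ := h
      refine ⟨u - (zigzag p : ℤ), ?_⟩
      have := infix_map_range (fun q => u - (zigzag p : ℤ) + ((zigzag q : ℤ) : ZMod (2 * m))) hp
      convert this using 2
      · simp
      · push_cast at hpe
        rw [sub_add_eq_add_sub, add_sub_assoc, ← hpe]; simp
    have hk0 : k ≠ 0 := by
      rintro rfl
      exact huv (sub_eq_zero.1 (by simpa using hxk)).symm
    -- The steps of the zigzag are 1, -2, 3, -4, …: odd differences occur directly, even ones as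
    -- negatives modulo 2m.
    rcases Nat.even_or_odd' k with ⟨q, rfl | rfl⟩
    · obtain ⟨r, rfl⟩ : ∃ r, q = m - (r + 1) := ⟨m - q - 1, by omega⟩
      refine ⟨2 * r + 1, by omega, ?_⟩
      rw [hxk, show 2 * r + 1 + 1 = 2 * (r + 1) by ring, zigzag_even, zigzag_odd, Nat.cast_mul,
        Nat.cast_sub (by omega)]
      push_cast
      rw [mul_sub, hself]; ring
    · refine ⟨2 * q, by omega, ?_⟩
      rw [hxk, zigzag_even, zigzag_odd]
      push_cast; ring

/-! ### Cycles on two copies of an odd set. -/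

/-- Doubling: from `m` vertices to `2 * m` vertices. -/
lemma HasPathDecomp.hasCycleDecomp_double {m : ℕ} (hm : Odd m) (hm3 : 3 ≤ m)
    (h : HasPathDecomp (ZMod m)) : HasCycleDecomp (ZMod m ⊕ ZMod m) := by
  have : NeZero m := ⟨by omega⟩
  have : Fact (1 < m) := ⟨by omega⟩
  obtain ⟨f, h1, h2, h3, h4, h5⟩ := h
  obtain ⟨half, hhalf⟩ := exists_two_inverse hm
  -- A cross cycle goes right by `i` and back by `s i - i`. With `s i = 1` throughout, `i = 1` would
  -- return by 0, a difference already supplied by the path cycles; the value 2 gives the missing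
  -- difference 1. Both values are units since `m` is odd.
  let s : {i : ZMod m // i ≠ 0} → ZMod m := fun i => if i.1 = 1 then 2 else 1
  have hs : ∀ i, ∃ r, r * s i = 1 := fun i => by
    by_cases hi : i.1 = 1
    · exact ⟨half, by simpa [s, hi] using hhalf⟩
    · exact ⟨1, by simp [s, hi]⟩
  let G : {i : ZMod m // i ≠ 0} → ℕ → List (ZMod m ⊕ ZMod m) := fun i t =>
    [Sum.inl (t * s i), Sum.inr (t * s i + i.1)]
  -- Path cycles run a path in the left copy and return along its reverse in the right one, so they
  -- cross only between twin vertices. The cross cycles take the other arcs between the copies.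
  let F : ZMod m ⊕ {i : ZMod m // i ≠ 0} → List (ZMod m ⊕ ZMod m) :=
    Sum.elim (fun i => (f i).map Sum.inl ++ (f i).reverse.map Sum.inr)
      (fun i => (List.range m).flatMap (G i))
  have hG : ∀ i (x : ZMod m), ∃ t < m, (t : ZMod m) * s i = x := fun i x => by
    obtain ⟨r, hr⟩ := hs i
    obtain ⟨t, ht, hxt⟩ := zmod_eq_natCast (x * r)
    exact ⟨t, ht, by rw [← hxt, mul_assoc, hr, mul_one]⟩
  have hfull : ∀ i x, x ∈ F i := by
    rintro (i | i) (x | x)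
    · simp [F, h2]
    · simp [F, h2]
    · obtain ⟨t, ht, hx⟩ := hG i x
      simp only [F, Sum.elim_inr, List.mem_flatMap, List.mem_range]
      exact ⟨t, ht, by simp [G, hx]⟩
    · obtain ⟨t, ht, hx⟩ := hG i (x - i.1)
      simp only [F, Sum.elim_inr, List.mem_flatMap, List.mem_range]
      exact ⟨t, ht, by simp [G, hx]⟩
  have hrot : ∀ (i : {i : ZMod m // i ≠ 0}) (t : ℕ), t < m → ∃ r, F (Sum.inr i) ~r
      Sum.inl (t * s i) :: Sum.inr (t * s i + i.1) :: Sum.inl (t * s i + s i) :: r := by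
    intro i t ht
    obtain ⟨r, hr⟩ := flatMap_range_isRotated (G i) (by omega) ht
    exact ⟨_, by simpa [G, F, add_mul] using hr⟩
  have hmem : ∀ {u v : ZMod m} {l : List (ZMod m)}, [u, v] <:+: l → ∀ {g : ZMod m → ZMod m ⊕ ZMod m}
      {a b}, ∃ t, a ++ (l.map g) ++ b ~r g u :: g v :: t := by
    rintro u v _ ⟨p, q, rfl⟩ g a b
    refine ⟨q.map g ++ b ++ (a ++ p.map g), ?_⟩
    simpa using List.isRotated_append (l := a ++ p.map g) (l' := g u :: g v :: (q.map g ++ b))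
  refine ⟨ZMod m ⊕ {i : ZMod m // i ≠ 0}, inferInstance, F, ?_, fun i => ?_, hfull, ?_⟩
  · have : Fintype.card {i : ZMod m // i ≠ 0} = m - 1 := by
      rw [Fintype.card_subtype_compl]; simp [ZMod.card]
    simp only [Nat.card_eq_fintype_card, Fintype.card_sum, ZMod.card, this]
    omega
  · refine nodup_of_length_eq_card (hfull i) ?_
    rcases i with i | i
    · simp [F, length_eq_card (h2 i) (h1 i), ZMod.card]
    · simp [F, G, ZMod.card]; omega
  · rintro (u | u) (v | v) huv
    · obtain ⟨i, hi⟩ := h5 u v (by simpa using huv)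
      exact ⟨Sum.inl i, by simpa [F] using hmem hi (g := Sum.inl) (a := [])⟩
    · by_cases hv : v = u
      · subst hv
        obtain ⟨i, hi⟩ := h4 v
        obtain ⟨l, hl⟩ := List.getLast?_eq_some_iff.1 hi
        refine ⟨Sum.inl i, l.reverse.map Sum.inr ++ l.map Sum.inl, ?_⟩
        simp only [F, Sum.elim_inl, hl]
        simpa using List.isRotated_append (l := l.map Sum.inl)
          (l' := Sum.inl v :: Sum.inr v :: l.reverse.map Sum.inr)
      · obtain ⟨t, ht, hx⟩ := hG ⟨v - u, sub_ne_zero.2 hv⟩ u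
        obtain ⟨r, hr⟩ := hrot ⟨v - u, sub_ne_zero.2 hv⟩ t ht
        simp only [hx, add_sub_cancel] at hr
        exact ⟨_, _, hr⟩
    · have hcross : ∀ i : {i : ZMod m // i ≠ 0}, v = u + (s i - i.1) →
          ∃ i t, F i ~r Sum.inr u :: Sum.inl v :: t := by
        intro i hv
        obtain ⟨t, ht, hx⟩ := hG i (u - i.1)
        obtain ⟨r, hr⟩ := hrot i t ht
        rw [hx, sub_add_cancel, show u - i.1 + s i = v by rw [hv]; ring] at hr
        refine ⟨_, r ++ [Sum.inl (u - i.1)], hr.trans ?_⟩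
        exact List.isRotated_append (l := [Sum.inl (u - i.1)])
          (l' := Sum.inr u :: Sum.inl v :: r)
      by_cases hv : v = u
      · subst hv
        obtain ⟨l, hl⟩ := List.head?_eq_some_iff.1 (h3 v)
        refine ⟨Sum.inl v, l.map Sum.inl ++ l.reverse.map Sum.inr, ?_⟩
        simp only [F, Sum.elim_inl, hl]
        simpa [-List.append_assoc, ← List.append_assoc] using
          List.isRotated_append (l := Sum.inl v :: (l.map Sum.inl ++ l.reverse.map Sum.inr))
          (l' := [Sum.inr v])
      · by_cases hv1 : v = u + 1
        · exact hcross ⟨1, one_ne_zero⟩ (by simp [s, hv1]; ring)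
        · have h1' : 1 - (v - u) ≠ 0 := fun h => hv1 (by linear_combination -h)
          have h2' : 1 - (v - u) ≠ 1 := fun h => hv (by linear_combination -h)
          exact hcross ⟨1 - (v - u), h1'⟩ (by simp [s, h2'])
    · obtain ⟨i, hi⟩ := h5 v u (by simpa [eq_comm] using huv)
      have hi' : [u, v] <:+: (f i).reverse := by simpa using List.reverse_infix.2 hi
      exact ⟨Sum.inl i, by simpa [F] using hmem hi' (g := Sum.inr) (b := [])⟩

/-! ### Cycles on an odd set, an even set and one extra vertex. -/

lemma exists_isRotated_cons_cons {l p q : List α} {u v : α} (h : l ~r p ++ u :: v :: q) :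
    ∃ t, l ~r u :: v :: t :=
  ⟨q ++ p, h.trans (by simpa using List.isRotated_append (l := p) (l' := u :: v :: q))⟩

lemma exists_isRotated_of_infix {l : List α} {u v : α} (h : [u, v] <:+: l) :
    ∃ t, l ~r u :: v :: t := by
  obtain ⟨p, q, rfl⟩ := h
  exact exists_isRotated_cons_cons (p := p) (q := q) (by simp [List.IsRotated.refl])

lemma infix_map_range_iff (g : ℕ → α) {m : ℕ} {u v : α} :
    [u, v] <:+: (List.range m).map g ↔ ∃ p, p + 1 < m ∧ g p = u ∧ g (p + 1) = v := by
  constructor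
  · rintro ⟨s, t, h⟩
    have hlen := congrArg List.length h
    simp at hlen
    have h1 := congrArg (·[s.length]?) h
    have h2 := congrArg (·[s.length + 1]?) h
    have e1 : s.length < m := by omega
    have e2 : s.length + 1 < m := by omega
    refine ⟨s.length, e2, ?_, ?_⟩
    · simpa [e1, eq_comm] using h1
    · simpa [e2, eq_comm] using h2
  · rintro ⟨p, hp, rfl, rfl⟩
    exact infix_map_range g hp

lemma length_flatMap_range (g : ℕ → List α) (n : ℕ) :
    ((List.range n).flatMap g).length = ∑ i ∈ Finset.range n, (g i).length := by
  induction n with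
  | zero => simp
  | succ n ih => simp [List.range_succ, Finset.sum_range_succ, ih]

lemma zmod_natCast_inj {c p t : ℕ} (hp : p < c) (ht : t < c) :
    (p : ZMod c) = t ↔ p = t := by
  rw [ZMod.natCast_eq_natCast_iff', Nat.mod_eq_of_lt hp, Nat.mod_eq_of_lt ht]

namespace CrossCycle

variable (c : ℕ)

/-- The vertex of `ZMod c` which the `t`-th cross cycle visits after its `z`-th stop outside. -/
def mid (t z : ℕ) : ZMod c := if t = c then 2 * z else if z = c then 2 * t else t + z

/-- What the `t`-th cross cycle visits between two consecutive stops in the outer part. -/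
def gap {Z : Type*} (t z : ℕ) : List (Option (ZMod c ⊕ Z)) :=
  if z = t then (if t = c then [none] else [])
  else some (Sum.inl (mid c t z)) :: (if t < c ∧ z = (t + 1) % c then [none] else [])

/-- The `t`-th cross cycle; `h` enumerates the outer part. -/
def cycle {Z : Type*} (h : ℕ → Z) (t : ℕ) : List (Option (ZMod c ⊕ Z)) :=
  (List.range (c + 1)).flatMap fun z => some (Sum.inr (h z)) :: gap c t z

variable {c} {Z : Type*} (h : ℕ → Z)

/-- Off its diagonal, `mid` is the addition table of `ZMod c` with the diagonal moved to an extra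
row and column. For odd `c` that diagonal 2t runs through all residues, so no row or column loses a
value. -/
lemma exists_mid_eq_left (hc : Odd c) (a : ZMod c) {z : ℕ} (hz : z ≤ c) :
    ∃ t ≤ c, t ≠ z ∧ mid c t z = a := by
  have : NeZero c := ⟨hc.pos.ne'⟩
  obtain ⟨r, hr⟩ := exists_two_inverse hc
  rcases hz.eq_or_lt with rfl | hz
  · obtain ⟨t, ht, e⟩ := zmod_eq_natCast (a * r)
    refine ⟨t, ht.le, ht.ne, ?_⟩
    rw [mid, if_neg ht.ne, if_pos rfl, ← e]
    linear_combination a * hr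
  · obtain ⟨t, ht, e⟩ := zmod_eq_natCast (a - (z : ZMod c))
    by_cases htz : t = z
    · subst htz
      refine ⟨c, le_rfl, hz.ne', ?_⟩
      rw [mid, if_pos rfl]
      linear_combination -e
    · refine ⟨t, ht.le, htz, ?_⟩
      rw [mid, if_neg ht.ne, if_neg hz.ne, ← e]
      ring

lemma mid_comm {t z : ℕ} (h : t ≠ z) : mid c t z = mid c z t := by
  unfold mid
  by_cases h1 : t = c <;> by_cases h2 : z = c
  · exact absurd (h1.trans h2.symm) h
  all_goals simp [h1, h2, add_comm]

lemma exists_mid_eq_right (hc : Odd c) (a : ZMod c) {t : ℕ} (ht : t ≤ c) :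
    ∃ z ≤ c, z ≠ t ∧ mid c t z = a := by
  obtain ⟨z, hz, hzt, e⟩ := exists_mid_eq_left hc a ht
  exact ⟨z, hz, hzt, by rw [mid_comm hzt.symm, e]⟩

lemma succ_mod_ne (hc : 2 ≤ c) {t : ℕ} (ht : t < c) : (t + 1) % c ≠ t := by
  rcases Nat.lt_or_ge (t + 1) c with h | h
  · rw [Nat.mod_eq_of_lt h]; omega
  · rw [show t + 1 = c by omega, Nat.mod_self]; omega

lemma mem_cycle (hc : Odd c) (hc3 : 3 ≤ c) (hh : ∀ z, ∃ k ≤ c, h k = z) {t : ℕ} (ht : t ≤ c)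
    (x : Option (ZMod c ⊕ Z)) : x ∈ cycle c h t := by
  simp only [cycle, List.mem_flatMap, List.mem_range, List.mem_cons]
  rcases x with _ | a | z
  · rcases ht.eq_or_lt with rfl | ht
    · exact ⟨t, by omega, Or.inr (by simp [gap])⟩
    · refine ⟨(t + 1) % c, (Nat.mod_lt _ (by omega)).trans (by omega), Or.inr ?_⟩
      simp [gap, succ_mod_ne (by omega : 2 ≤ c) ht, ht]
  · obtain ⟨z, hz, hzt, e⟩ := exists_mid_eq_right hc a ht
    exact ⟨z, by omega, Or.inr (by simp [gap, hzt, e])⟩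
  · obtain ⟨k, hk, rfl⟩ := hh z
    exact ⟨k, by omega, Or.inl rfl⟩

lemma length_cycle (hc3 : 3 ≤ c) {t : ℕ} (ht : t ≤ c) : (cycle c h t).length = 2 * c + 2 := by
  -- A block has length 2, less one at `z = t`, where the inner vertex is skipped, plus one where
  -- `none` is inserted. The deficit is put on the left to avoid subtraction.
  have e : ∀ z ∈ Finset.range (c + 1), (some (Sum.inr (h z)) :: gap c t z).length +
      (if z = t then 1 else 0) = 2 + (if z = (if t < c then (t + 1) % c else t) then 1 else 0) := by
    intro z _
    rcases ht.eq_or_lt with rfl | ht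
    · by_cases hz : z = t <;> simp [gap, hz]
    · have := succ_mod_ne (by omega : 2 ≤ c) ht
      by_cases hz : z = t
      · simp [gap, hz, ht, ht.ne, this.symm]
      · by_cases hz' : z = (t + 1) % c <;> simp [gap, hz, ht, hz', this]
  have s := Finset.sum_congr rfl e
  rw [Finset.sum_add_distrib, Finset.sum_add_distrib, Finset.sum_ite_eq', Finset.sum_ite_eq',
    if_pos (by simp; omega), if_pos] at s
  · have : (cycle c h t).length =
        ∑ z ∈ Finset.range (c + 1), (some (Sum.inr (h z)) :: gap c t z).length := by
      rw [cycle, length_flatMap_range]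
    rw [this]
    simp at s
    simp
    omega
  · split_ifs with h'
    · exact Finset.mem_range.2 ((Nat.mod_lt _ (by omega)).trans (by omega))
    · exact Finset.mem_range.2 (by omega)

lemma cycle_isRotated (hc3 : 3 ≤ c) (t : ℕ) {z : ℕ} (hz : z ≤ c) :
    ∃ r, cycle c h t ~r some (Sum.inr (h z)) :: (gap c t z ++
      some (Sum.inr (h ((z + 1) % (c + 1)))) :: r) := by
  obtain ⟨r, hr⟩ := flatMap_range_isRotated
    (fun z => some (Sum.inr (h z)) :: gap c t z) (m := c + 1) (t := z) (by omega) (by omega)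
  exact ⟨_, by simpa [cycle] using hr⟩

end CrossCycle

open CrossCycle in
/-- From `c` vertices to `2 * c + 2` vertices. -/
lemma HasPathDecomp.hasCycleDecomp_cross {c : ℕ} (hc : Odd c) (hc3 : 3 ≤ c) {Z : Type*} [Finite Z]
    (hZ : Nat.card Z = c + 1) (hA : HasPathDecomp (ZMod c)) (hB : HasPathDecomp Z) :
    HasCycleDecomp (Option (ZMod c ⊕ Z)) := by
  have : NeZero c := ⟨by omega⟩
  have : Nonempty Z := Nat.card_ne_zero.1 (by omega) |>.1
  obtain ⟨z0⟩ := this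
  obtain ⟨f, f1, f2, f3, f4, f5⟩ := hA
  obtain ⟨g, g1, g2, g3, g4, g5⟩ := hB
  obtain ⟨half, hhalf⟩ := exists_two_inverse hc
  choose k hk using f4
  have kinj : Function.Injective k := fun u v huv => by
    have := hk u
    rw [huv, hk v] at this
    simpa using this.symm
  have kbij : Function.Bijective k := Finite.injective_iff_bijective.1 kinj
  have glen : ∀ i, (g i).length = c + 1 := fun i => by rw [length_eq_card (g2 i) (g1 i), hZ]
  obtain ⟨h, hh⟩ : ∃ h : ℕ → Z, g z0 = (List.range (c + 1)).map h := by
    -- The default `z0` is never read, since only indices up to `c` occur.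
    refine ⟨fun n => (g z0).getD n z0, List.ext_getElem (by simp [glen]) fun n h1 h2 => ?_⟩
    simp [h1]
  have hsurj : ∀ z, ∃ k ≤ c, h k = z := fun z => by
    have := g2 z0 z
    rw [hh, List.mem_map] at this
    obtain ⟨k, hk, e⟩ := this
    exact ⟨k, by simpa [Nat.lt_succ_iff] using hk, e⟩
  have hinj : ∀ {i j}, i ≤ c → j ≤ c → (h i = h j ↔ i = j) := fun {i j} hi hj => by
    have := g1 z0
    rw [hh] at this
    exact ⟨fun e => List.inj_on_of_nodup_map this (by simp; omega) (by simp; omega) e,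
      fun e => by rw [e]⟩
  have h0 : h 0 = z0 := by
    have := g3 z0
    rw [hh, List.range_succ_eq_map] at this
    simpa using this
  have hlast : (g z0).getLast? = some (h c) := by
    rw [hh, List.range_succ]; simp
  -- Inserting `none` in cross cycle t after the inner vertex 2t + 1 interrupts one arc from each
  -- inner vertex to the outer part; `φ` gives the head of that arc. It misses only `h 0 = z0`.
  let φ : ZMod c → Z := fun a => h (((a + 1) * half).val + 1)
  have φval : ∀ {a : ZMod c} {p : ℕ}, p < c → (φ a = h (p + 1) ↔ a = 2 * p - 1) := by
    intro a p hp
    have hlt := ZMod.val_lt ((a + 1) * half)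
    rw [show φ a = h (((a + 1) * half).val + 1) from rfl, hinj (by omega) (by omega),
      Nat.add_right_cancel_iff, ← zmod_natCast_inj hlt hp, ZMod.natCast_zmod_val]
    constructor
    · intro e; linear_combination 2 * e - (a + 1) * hhalf
    · intro e; linear_combination half * e + (p : ZMod c) * hhalf
  have φsurj : ∀ z, z ≠ z0 → ∃ a, φ a = z := fun z hz => by
    obtain ⟨k, hk, rfl⟩ := hsurj z
    obtain ⟨p, rfl⟩ : ∃ p, k = p + 1 :=
      Nat.exists_eq_succ_of_ne_zero (by rintro rfl; exact hz h0)
    exact ⟨_, (φval (by omega)).2 rfl⟩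
  -- The inner path ending at `v` is linked to the outer path beginning at `φ v`, which restores the
  -- interrupted arcs. The one unused outer path, from `z0`, supplies the direct arcs of the cross
  -- cycles.
  let F : ZMod c ⊕ Fin (c + 1) → List (Option (ZMod c ⊕ Z)) :=
    Sum.elim (fun v => (f (k v)).map (fun a => some (Sum.inl a)) ++
      (g (φ v)).map (fun z => some (Sum.inr z)) ++ [none]) (fun t => cycle c h t)
  have hfull : ∀ i x, x ∈ F i := by
    rintro (i | i) x
    · rcases x with _ | a | z <;> simp [F, f2, g2]
    · exact mem_cycle h hc hc3 hsurj (by omega) x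
  have hcard : Nat.card (Option (ZMod c ⊕ Z)) = 2 * c + 2 := by
    rw [Finite.card_option, Nat.card_sum, hZ, Nat.card_zmod]; omega
  have hA : ∀ {v u w}, [u, w] <:+: F (Sum.inl v) → ∃ i t, F i ~r u :: w :: t := fun {v u w} H =>
    ⟨Sum.inl v, exists_isRotated_of_infix H⟩
  have hB : ∀ {t z u w p q}, t ≤ c → z ≤ c →
      some (Sum.inr (h z)) :: (gap c t z ++ [some (Sum.inr (h ((z + 1) % (c + 1))))]) =
        p ++ u :: w :: q → ∃ i t, F i ~r u :: w :: t := by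
    intro t z u w p q ht hz e
    obtain ⟨r, hr⟩ := cycle_isRotated h hc3 t hz
    refine ⟨Sum.inr ⟨t, by omega⟩, exists_isRotated_cons_cons (p := p) (q := q ++ r) (hr.trans ?_)⟩
    have := congrArg (· ++ r) e
    simp only [List.cons_append, List.append_assoc, List.nil_append] at this
    rw [this]
  refine ⟨ZMod c ⊕ Fin (c + 1), inferInstance, F, ?_, fun i => ?_, hfull, ?_⟩
  · rw [hcard, Nat.card_sum, Nat.card_zmod, Nat.card_fin]; omega
  · refine nodup_of_length_eq_card (hfull i) ?_
    rw [hcard]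
    rcases i with i | i
    · simp [F, length_eq_card (f2 _) (f1 _), glen]; omega
    · exact length_cycle h hc3 (by omega)
  · rintro (_ | a | z) (_ | a' | z') huv
    · exact absurd rfl huv
    · -- from the extra vertex to the inner part
      obtain ⟨v, rfl⟩ := kbij.2 a'
      obtain ⟨l, hl⟩ := List.head?_eq_some_iff.1 (f3 (k v))
      refine ⟨Sum.inl v, l.map (fun a => some (Sum.inl a)) ++
        (g (φ v)).map (fun z => some (Sum.inr z)), ?_⟩
      simp only [F, Sum.elim_inl]
      rw [hl]
      exact List.isRotated_append
    · obtain ⟨j, hj, rfl⟩ := hsurj z'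
      rcases j with _ | j
      · exact hB (t := c) (z := c) le_rfl le_rfl (p := [_]) (q := []) (by simp [gap]; rfl)
      -- This is j - 1 modulo c: cross cycle `t` inserts `none` in gap t + 1.
      · let t := (j + (c - 1)) % c
        have ht : t < c := Nat.mod_lt _ (by omega)
        have htj : (t + 1) % c = j := by
          rw [Nat.mod_add_mod, show j + (c - 1) + 1 = j + c by omega, Nat.add_mod_right,
            Nat.mod_eq_of_lt (by omega)]
        have hne : j ≠ t := by
          rw [← htj]; exact succ_mod_ne (by omega) ht
        refine hB (t := t) (z := j) ht.le (by omega)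
          (p := [some (Sum.inr (h j)), some (Sum.inl (mid c t j))]) (q := []) ?_
        rw [gap, if_neg hne, if_pos ⟨ht, htj.symm⟩, Nat.mod_eq_of_lt (by omega)]
        rfl
    · -- from the inner part to the extra vertex
      obtain ⟨t, ht, e⟩ := zmod_eq_natCast ((a - 1) * half)
      have hz : (t + 1) % c < c := Nat.mod_lt _ (by omega)
      refine hB (t := t) (z := (t + 1) % c) ht.le hz.le
        (p := [some (Sum.inr (h ((t + 1) % c)))])
        (q := [some (Sum.inr (h (((t + 1) % c + 1) % (c + 1))))]) ?_
      rw [gap, if_neg (succ_mod_ne (by omega) ht), if_pos ⟨ht, rfl⟩, mid, if_neg ht.ne, if_neg hz.ne,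
        ZMod.natCast_mod]
      rw [show a = t + ((t + 1 : ℕ) : ZMod c) by
        push_cast; rw [← e]; linear_combination (1 - a) * hhalf]
      rfl
    · obtain ⟨i, hi⟩ := f5 a a' (by simpa using huv)
      obtain ⟨v, rfl⟩ := kbij.2 i
      refine hA (v := v) ?_
      have := hi.map (fun a : ZMod c => (some (Sum.inl a) : Option (ZMod c ⊕ Z)))
      simp only [F, Sum.elim_inl, List.append_assoc]
      exact this.trans (List.infix_append [] _ _)
    · -- from the inner part to the outer part
      obtain ⟨j, hj, rfl⟩ := hsurj z'
      rcases j with _ | p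
      · obtain ⟨t, ht, e⟩ := zmod_eq_natCast (a * half)
        refine hB (t := t) (z := c) ht.le le_rfl (p := [some (Sum.inr (h c))]) (q := []) ?_
        have : c ≠ (t + 1) % c := (Nat.mod_lt _ (by omega)).ne'
        rw [gap, if_neg ht.ne', if_neg (by simp [this]), mid, if_neg ht.ne, if_pos rfl, Nat.mod_self,
          ← e]
        rw [show 2 * (a * half) = a by linear_combination a * hhalf]
        rfl
      · have hp : p < c := by omega
        -- Exactly the arcs interrupted by `none` are taken from the path cycles.
        by_cases hφ : φ a = h (p + 1)
        · refine hA (v := a) ?_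
          obtain ⟨l, hl⟩ := List.getLast?_eq_some_iff.1 (hk a)
          obtain ⟨l', hl'⟩ := List.head?_eq_some_iff.1 (g3 (φ a))
          simp only [F, Sum.elim_inl]
          rw [hl, hl', hφ]
          exact ⟨l.map (fun a => some (Sum.inl a)),
            l'.map (fun z => some (Sum.inr z)) ++ [none], by simp⟩
        · have hmod : (p + 1) % (c + 1) = p + 1 := Nat.mod_eq_of_lt (by omega)
          rw [φval hp] at hφ
          obtain ⟨t, ht, e⟩ := zmod_eq_natCast (a - (p : ZMod c))
          -- A diagonal position of the addition table has been moved to cross cycle `c`.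
          by_cases htp : p = t
          · refine hB (t := c) (z := p) le_rfl hp.le (p := [some (Sum.inr (h p))]) (q := []) ?_
            rw [gap, if_neg hp.ne, if_neg (by simp), mid, if_pos rfl, hmod]
            rw [show a = 2 * p by subst htp; linear_combination e]
            rfl
          · refine hB (t := t) (z := p) ht.le hp.le (p := [some (Sum.inr (h p))]) (q := []) ?_
            rw [gap, if_neg htp, if_neg, mid, if_neg ht.ne, if_neg hp.ne, hmod]
            · rw [show a = t + p by rw [← e]; ring]
              rfl
            · rintro ⟨-, e'⟩
              have := congrArg (Nat.cast : ℕ → ZMod c) e'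
              rw [ZMod.natCast_mod] at this
              push_cast at this
              exact hφ (by linear_combination e - this)
    · obtain ⟨j, hj, rfl⟩ := hsurj z
      by_cases hjc : j = c
      · subst hjc
        exact hB (t := j) (z := j) le_rfl le_rfl (p := []) (q := [_]) (by simp [gap]; rfl)
      · obtain ⟨i, hi⟩ := g4 (h j)
        have hi0 : i ≠ z0 := by
          rintro rfl
          rw [hlast, Option.some_inj, hinj le_rfl hj] at hi
          exact hjc hi.symm
        obtain ⟨v, rfl⟩ := φsurj i hi0
        obtain ⟨l, hl⟩ := List.getLast?_eq_some_iff.1 hi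
        refine hA (v := v) ?_
        simp only [F, Sum.elim_inl]
        rw [hl]
        exact ⟨(f (k v)).map (fun a => some (Sum.inl a)) ++ l.map (fun z => some (Sum.inr z)), [],
          by simp⟩
    · -- from the outer part to the inner part
      obtain ⟨j, hj, rfl⟩ := hsurj z
      obtain ⟨t, ht, htj, e⟩ := exists_mid_eq_left hc a' hj
      obtain ⟨r, hr⟩ : ∃ r, gap (Z := Z) c t j = some (Sum.inl a') :: r := by
        rw [gap, if_neg htj.symm, e]; exact ⟨_, rfl⟩
      exact hB (t := t) (z := j) ht hj (p := []) (q := r ++ [_]) (by rw [hr]; rfl)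
    · obtain ⟨i, hi⟩ := g5 z z' (by simpa using huv)
      by_cases hi0 : i = z0
      · subst hi0
        rw [hh, infix_map_range_iff] at hi
        obtain ⟨p, hp, rfl, rfl⟩ := hi
        refine hB (t := p) (z := p) (by omega) (by omega) (p := []) (q := []) ?_
        rw [gap, if_pos rfl, if_neg (by omega), Nat.mod_eq_of_lt hp]
        rfl
      · obtain ⟨v, rfl⟩ := φsurj i hi0
        refine hA (v := v) ?_
        have := hi.map (fun z : Z => (some (Sum.inr z) : Option (ZMod c ⊕ Z)))
        simp only [F, Sum.elim_inl]
        exact this.trans (List.infix_append _ _ _)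

/-! ### Small orders and the induction on the order. -/

lemma hasPathDecomp_of_subsingleton [Subsingleton α] : HasPathDecomp α :=
  ⟨fun i => [i], by simp, fun i x => by simp [Subsingleton.elim x i], by simp, fun v => ⟨v, rfl⟩,
    fun u v h => absurd (Subsingleton.elim u v) h⟩

lemma hasPathDecomp_seven : HasPathDecomp (Fin 7) := by
  suffices h : ∃ f : Fin 7 → List (Fin 7), (∀ i, (f i).Nodup) ∧ (∀ i x, x ∈ f i) ∧
      (∀ i, (f i).head? = some i) ∧ (∀ v, ∃ i, (f i).getLast? = some v) ∧
      ∀ u v, u ≠ v → ∃ i, (u, v) ∈ arcs (f i) by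
    simpa only [HasPathDecomp, mem_arcs_iff] using h
  exact ⟨![[0, 6, 3, 4, 2, 5, 1],
    [1, 4, 0, 5, 6, 2, 3],
    [2, 1, 6, 4, 5, 3, 0],
    [3, 6, 0, 1, 5, 2, 4],
    [4, 6, 1, 2, 0, 3, 5],
    [5, 0, 4, 1, 3, 2, 6],
    [6, 5, 4, 3, 1, 0, 2]],
    by decide +kernel, by decide +kernel, by decide +kernel, by decide +kernel, by decide +kernel⟩

lemma hasPathDecomp_nine : HasPathDecomp (Fin 9) := by
  suffices h : ∃ f : Fin 9 → List (Fin 9), (∀ i, (f i).Nodup) ∧ (∀ i x, x ∈ f i) ∧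
      (∀ i, (f i).head? = some i) ∧ (∀ v, ∃ i, (f i).getLast? = some v) ∧
      ∀ u v, u ≠ v → ∃ i, (u, v) ∈ arcs (f i) by
    simpa only [HasPathDecomp, mem_arcs_iff] using h
  exact ⟨![[0, 2, 1, 8, 5, 6, 4, 7, 3],
    [1, 6, 0, 7, 8, 3, 4, 2, 5],
    [2, 0, 3, 7, 4, 6, 5, 8, 1],
    [3, 5, 4, 8, 0, 1, 7, 2, 6],
    [4, 1, 3, 2, 8, 6, 7, 5, 0],
    [5, 3, 6, 2, 7, 1, 0, 8, 4],
    [6, 8, 2, 3, 1, 4, 0, 5, 7],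
    [7, 0, 6, 1, 5, 2, 4, 3, 8],
    [8, 7, 6, 3, 0, 4, 5, 1, 2]],
    by decide +kernel, by decide +kernel, by decide +kernel, by decide +kernel, by decide +kernel⟩

lemma hasPathDecomp_eleven : HasPathDecomp (Fin 11) := by
  suffices h : ∃ f : Fin 11 → List (Fin 11), (∀ i, (f i).Nodup) ∧ (∀ i x, x ∈ f i) ∧
      (∀ i, (f i).head? = some i) ∧ (∀ v, ∃ i, (f i).getLast? = some v) ∧
      ∀ u v, u ≠ v → ∃ i, (u, v) ∈ arcs (f i) by
    simpa only [HasPathDecomp, mem_arcs_iff] using h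
  exact ⟨![[0, 1, 2, 6, 9, 7, 10, 3, 8, 4, 5],
    [1, 9, 2, 8, 3, 7, 4, 6, 5, 10, 0],
    [2, 0, 3, 9, 4, 8, 5, 7, 6, 10, 1],
    [3, 4, 2, 5, 1, 6, 0, 7, 9, 8, 10],
    [4, 9, 3, 0, 2, 1, 10, 6, 7, 5, 8],
    [5, 3, 6, 2, 7, 1, 8, 0, 9, 10, 4],
    [6, 3, 5, 4, 10, 9, 0, 8, 1, 7, 2],
    [7, 0, 6, 1, 5, 2, 4, 3, 10, 8, 9],
    [8, 2, 9, 1, 0, 10, 5, 6, 4, 7, 3],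
    [9, 5, 0, 4, 1, 3, 2, 10, 7, 8, 6],
    [10, 2, 3, 1, 4, 0, 5, 9, 6, 8, 7]],
    by decide +kernel, by decide +kernel, by decide +kernel, by decide +kernel, by decide +kernel⟩

lemma HasPathDecomp.of_card_eq [Finite α] [Finite β] (h : HasPathDecomp α)
    (e : Nat.card α = Nat.card β) : HasPathDecomp β :=
  h.congr (Finite.card_eq.1 e).some

lemma HasCycleDecomp.hasPathDecomp_of_card [Finite α] [Finite β] (h : HasCycleDecomp α)
    (e : Nat.card α = Nat.card β + 1) : HasPathDecomp β :=
  (h.congr (Finite.card_eq.1 (e.trans Finite.card_option.symm)).some).hasPathDecomp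

theorem hasPathDecomp_fin (n : ℕ) (h3 : n ≠ 3) (h5 : n ≠ 5) : HasPathDecomp (Fin n) := by
  have heven : ∀ m : ℕ, 0 < m → HasPathDecomp (Fin (2 * m)) := fun m hm => by
    have : NeZero m := ⟨hm.ne'⟩
    exact (hasPathDecomp_even m).of_card_eq (by simp)
  induction n using Nat.strong_induction_on with
  | _ n ih =>
    rcases Nat.even_or_odd' n with ⟨m, rfl | rfl⟩
    · rcases Nat.eq_zero_or_pos m with rfl | hm
      · exact hasPathDecomp_of_subsingleton (α := Fin 0)
      · exact heven m hm
    -- From order 13 on, the half-size order is at least 7 and so avoids 3 and 5; orders 7, 9 and 11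
    -- would fall back on 3 or 5.
    · by_cases h11 : m ≤ 5
      · interval_cases m
        · exact hasPathDecomp_of_subsingleton (α := Fin 1)
        · omega
        · omega
        · exact hasPathDecomp_seven
        · exact hasPathDecomp_nine
        · exact hasPathDecomp_eleven
      · rcases Nat.even_or_odd' m with ⟨k, rfl | rfl⟩
        · have : NeZero (2 * k + 1) := ⟨by omega⟩
          have hk : HasPathDecomp (ZMod (2 * k + 1)) :=
            (ih (2 * k + 1) (by omega) (by omega) (by omega)).of_card_eq (by simp)
          exact (hk.hasCycleDecomp_double ⟨k, rfl⟩ (by omega)).hasPathDecomp_of_card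
            (by simp; omega)
        · have : NeZero (2 * k + 1) := ⟨by omega⟩
          have hk : HasPathDecomp (ZMod (2 * k + 1)) :=
            (ih (2 * k + 1) (by omega) (by omega) (by omega)).of_card_eq (by simp)
          have hZ : Nat.card (Fin (2 * (k + 1))) = 2 * k + 1 + 1 := by simp; omega
          refine (hk.hasCycleDecomp_cross ⟨k, rfl⟩ (by omega) hZ
            (heven (k + 1) (by omega))).hasPathDecomp_of_card ?_
          rw [Finite.card_option, Nat.card_sum, hZ]
          simp
          omega

/-! ### Covers by paths: cutting and joining. -/

/-- `C` is a family of directed paths on the vertices in `A` which cover every arc as often as it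
occurs in `E`, and whose initial vertices, like their final vertices, form the multiset `S`. -/
structure IsCover (A : Finset α) (E : Multiset (α × α)) (S : Multiset α)
    (C : Multiset (List α)) : Prop where
  nodup : ∀ l ∈ C, l.Nodup
  subset : ∀ l ∈ C, ∀ x ∈ l, x ∈ A
  bind_arcs : C.bind (fun l => (arcs l : Multiset (α × α))) = E
  heads : C.map List.head? = S.map some
  lasts : C.map List.getLast? = S.map some

namespace IsCover

variable {A B : Finset α} {E E' : Multiset (α × α)} {S S' : Multiset α} {C C' : Multiset (List α)}

lemma add [DecidableEq α] (h : IsCover A E S C) (h' : IsCover B E' S' C') :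
    IsCover (A ∪ B) (E + E') (S + S') (C + C') where
  nodup l hl := (Multiset.mem_add.1 hl).elim (h.nodup l) (h'.nodup l)
  subset l hl x hx := Finset.mem_union.2 ((Multiset.mem_add.1 hl).imp
    (fun H => h.subset l H x hx) (fun H => h'.subset l H x hx))
  bind_arcs := by rw [Multiset.add_bind, h.bind_arcs, h'.bind_arcs]
  heads := by rw [Multiset.map_add, Multiset.map_add, h.heads, h'.heads]
  lasts := by rw [Multiset.map_add, Multiset.map_add, h.lasts, h'.lasts]

lemma map (h : IsCover A E S C) (g : α ↪ β) :
    IsCover (A.map g) (E.map (Prod.map g g)) (S.map g) (C.map (List.map g)) where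
  nodup := by
    intro l hl
    obtain ⟨l, hl', rfl⟩ := Multiset.mem_map.1 hl
    exact (h.nodup l hl').map g.injective
  subset := by
    intro l hl x hx
    obtain ⟨l, hl', rfl⟩ := Multiset.mem_map.1 hl
    obtain ⟨x, hx', rfl⟩ := List.mem_map.1 hx
    exact Finset.mem_map_of_mem g (h.subset l hl' x hx')
  bind_arcs := by
    rw [← h.bind_arcs, Multiset.map_bind, Multiset.bind_map]
    simp [arcs_map]
  heads := by
    have := congrArg (Multiset.map (Option.map g)) h.heads
    simpa [Function.comp_def] using this
  lasts := by
    have := congrArg (Multiset.map (Option.map g)) h.lasts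
    simpa [Function.comp_def] using this

/-- Concatenation at `v` keeps all arcs and uses up one beginning and one end at `v`. -/
lemma join {q p : List α} {v : α} {R : Multiset (List α)}
    (h : IsCover A E ({v} + S) ({q ++ [v]} + {v :: p} + R)) (hd : ∀ x ∈ q, x ∉ p) :
    IsCover A E S ({q ++ v :: p} + R) := by
  have h1 := h.nodup (q ++ [v]) (by simp)
  have h2 := h.nodup (v :: p) (by simp)
  refine ⟨fun l hl => ?_, fun l hl x hx => ?_, ?_, ?_, ?_⟩
  · rcases Multiset.mem_add.1 hl with hl | hl
    · rw [Multiset.mem_singleton.1 hl]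
      refine List.Nodup.append (List.nodup_append.1 h1).1 h2 fun x hx hx' => ?_
      rcases List.mem_cons.1 hx' with rfl | hx'
      · exact (List.nodup_append.1 h1).2.2 x hx x (by simp) rfl
      · exact hd x hx hx'
    · exact h.nodup l (by simp [hl])
  · rcases Multiset.mem_add.1 hl with hl | hl
    · rw [Multiset.mem_singleton.1 hl] at hx
      rcases List.mem_append.1 hx with hx | hx
      · exact h.subset (q ++ [v]) (by simp) x (by simp [hx])
      · exact h.subset (v :: p) (by simp) x hx
    · exact h.subset l (by simp [hl]) x hx
  · rw [← h.bind_arcs]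
    simp only [Multiset.add_bind, Multiset.singleton_bind]
    rw [arcs_append q p v, ← Multiset.coe_add]
  · have := h.heads
    simp only [Multiset.map_add, Multiset.map_singleton] at this ⊢
    refine add_left_cancel (a := {some v}) (this ▸ ?_)
    simp
  · have := h.lasts
    simp only [Multiset.map_add, Multiset.map_singleton] at this ⊢
    refine add_left_cancel (a := {some v}) (this ▸ ?_)
    simpa [List.getLast?_append, List.getLast?_cons] using Multiset.cons_swap _ _ _

lemma split {q p : List α} {v : α} {R : Multiset (List α)}
    (h : IsCover A E S ({q ++ v :: p} + R)) :
    IsCover A E ({v} + S) ({q ++ [v]} + {v :: p} + R) := by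
  have h1 := h.nodup (q ++ v :: p) (by simp)
  have h2 := h.subset (q ++ v :: p) (by simp)
  refine ⟨fun l hl => ?_, fun l hl x hx => ?_, ?_, ?_, ?_⟩
  · rcases Multiset.mem_add.1 hl with hl | hl
    · rcases Multiset.mem_add.1 hl with hl | hl
      · rw [Multiset.mem_singleton.1 hl]
        exact h1.sublist ((List.Sublist.refl q).append (by simp))
      · rw [Multiset.mem_singleton.1 hl]
        exact h1.sublist (List.sublist_append_right _ _)
    · exact h.nodup l (by simp [hl])
  · rcases Multiset.mem_add.1 hl with hl | hl
    · rcases Multiset.mem_add.1 hl with hl | hl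
      · rw [Multiset.mem_singleton.1 hl] at hx
        simp at hx
        exact h2 x (by simp; tauto)
      · rw [Multiset.mem_singleton.1 hl] at hx
        exact h2 x (by simp at hx ⊢; tauto)
    · exact h.subset l (by simp [hl]) x hx
  · rw [← h.bind_arcs]
    simp only [Multiset.add_bind, Multiset.singleton_bind]
    rw [arcs_append q p v, ← Multiset.coe_add]
  · rw [Multiset.map_add some, ← h.heads]
    simp only [Multiset.map_add, Multiset.map_singleton]
    simp
  · rw [Multiset.map_add some, ← h.lasts]
    simp only [Multiset.map_add, Multiset.map_singleton]
    simpa [List.getLast?_append, List.getLast?_cons] using Multiset.cons_swap _ _ _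

lemma exists_cons (h : IsCover A E S C) {v : α} (hv : v ∈ S) : ∃ p, v :: p ∈ C := by
  have : some v ∈ C.map List.head? := by rw [h.heads]; exact Multiset.mem_map_of_mem _ hv
  obtain ⟨l, hl, e⟩ := Multiset.mem_map.1 this
  obtain ⟨p, rfl⟩ := List.head?_eq_some_iff.1 e
  exact ⟨p, hl⟩

lemma exists_concat (h : IsCover A E S C) {v : α} (hv : v ∈ S) : ∃ q, q ++ [v] ∈ C := by
  have : some v ∈ C.map List.getLast? := by rw [h.lasts]; exact Multiset.mem_map_of_mem _ hv
  obtain ⟨l, hl, e⟩ := Multiset.mem_map.1 this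
  obtain ⟨p, rfl⟩ := List.getLast?_eq_some_iff.1 e
  exact ⟨p, hl⟩

/-- If some arc enters `v`, a path ending at `v` and a path starting at `v` can be taken to be two
different members of the family. -/
lemma exists_concat_cons (h : IsCover A E S C) {u v : α} (hv : v ∈ S) (huv : (u, v) ∈ E) :
    ∃ q p R, IsCover A E S ({q ++ [v]} + {v :: p} + R) := by
  obtain ⟨q, hq⟩ := h.exists_concat hv
  obtain ⟨p, hp⟩ := h.exists_cons hv
  obtain ⟨R, rfl⟩ := Multiset.exists_cons_of_mem hq
  -- A path without repetition that begins and ends at `v` is trivial. In that case, a path through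
  -- the arc entering `v` is cut at `v`, and the trivial path is absorbed into its second half.
  rcases Multiset.mem_cons.1 hp with e | hp
  · have hnd := h.nodup _ hq
    obtain rfl : q = [] := by
      cases q with
      | nil => rfl
      | cons a q =>
        simp only [List.cons_append, List.cons.injEq] at e
        obtain ⟨rfl, -⟩ := e
        simp at hnd
    rw [← h.bind_arcs, Multiset.mem_bind] at huv
    obtain ⟨l, hl, hl'⟩ := huv
    rcases Multiset.mem_cons.1 hl with rfl | hl
    · simp at hl'
    obtain ⟨s, t, rfl⟩ := mem_arcs_iff.1 (Multiset.mem_coe.1 hl')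
    obtain ⟨R, rfl⟩ := Multiset.exists_cons_of_mem hl
    refine ⟨s ++ [u], t, R, ?_⟩
    have h1 : IsCover A E S ({(s ++ [u]) ++ v :: t} + ({[v]} + R)) := by
      convert h using 1
      simp [← Multiset.singleton_add]
      exact add_left_comm _ _ _
    have h2 : IsCover A E ({v} + S) ({[] ++ [v]} + {v :: t} + ({s ++ [u] ++ [v]} + R)) := by
      convert h1.split using 1
      simpa using Multiset.cons_swap _ _ _
    convert h2.join (by simp) using 1
    simp
  · obtain ⟨R, rfl⟩ := Multiset.exists_cons_of_mem hp
    refine ⟨q, p, R, ?_⟩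
    convert h using 1
    simp [← Multiset.singleton_add, add_assoc]

end IsCover

/-! ### Gluing covers that share one vertex. -/

lemma disjoint_of_inter_eq_singleton [DecidableEq α] {A B : Finset α} {v : α} (hAB : A ∩ B = {v})
    {q p : List α} (hq : (q ++ [v]).Nodup) (hqA : ∀ x ∈ q ++ [v], x ∈ A)
    (hpB : ∀ x ∈ v :: p, x ∈ B) : ∀ x ∈ q, x ∉ p := by
  intro x hx hx'
  have : x ∈ A ∩ B := Finset.mem_inter.2 ⟨hqA x (by simp [hx]), hpB x (by simp [hx'])⟩
  rw [hAB, Finset.mem_singleton] at this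
  subst this
  exact (List.nodup_append.1 hq).2.2 x hx x (by simp) rfl

lemma val_add_val_of_inter [DecidableEq α] {A B : Finset α} {v : α} (hAB : A ∩ B = {v}) :
    A.val + B.val = {v} + (A ∪ B).val := by
  have := Multiset.union_add_inter A.val B.val
  rw [← Finset.inter_val, ← Finset.union_val, hAB] at this
  rw [← this, add_comm]; rfl

/-- A cover of `A` in which two paths start and two paths end at `v`. -/
def HasDoubleCover (A : Finset α) (E : Multiset (α × α)) (v : α) : Prop :=
  ∃ q q' p p' R, IsCover A E ({v} + A.val)
    ({q ++ [v]} + {q' ++ [v]} + {v :: p} + {v :: p'} + R)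

section Glue

variable [DecidableEq α] {A B : Finset α} {E E' : Multiset (α × α)} {v : α}

lemma IsCover.glue {C C' : Multiset (List α)} (hAB : A ∩ B = {v}) (h : IsCover A E A.val C)
    (h' : IsCover B E' B.val C') : ∃ D, IsCover (A ∪ B) (E + E') (A ∪ B).val D := by
  have hv : v ∈ A ∩ B := by simp [hAB]
  obtain ⟨hvA, hvB⟩ := Finset.mem_inter.1 hv
  obtain ⟨q, hq⟩ := h.exists_concat hvA
  obtain ⟨p, hp⟩ := h'.exists_cons hvB
  have hd := disjoint_of_inter_eq_singleton hAB (h.nodup _ hq) (h.subset _ hq) (h'.subset _ hp)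
  obtain ⟨R, rfl⟩ := Multiset.exists_cons_of_mem hq
  obtain ⟨R', rfl⟩ := Multiset.exists_cons_of_mem hp
  have H := h.add h'
  rw [val_add_val_of_inter hAB] at H
  refine ⟨_, IsCover.join (q := q) (p := p) (v := v) (R := R + R') ?_ hd⟩
  convert H using 1
  simp only [← Multiset.singleton_add]
  abel

/-- Now `v` is a beginning three times, so two joins are needed, one in each direction. The arc
entering `v` provides two different paths of `B`; a trivial path used for both would link two paths
inside `A`. -/
lemma HasDoubleCover.glue {C' : Multiset (List α)} (hAB : A ∩ B = {v}) (h : HasDoubleCover A E v)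
    (h' : IsCover B E' B.val C') {u : α} (hu : (u, v) ∈ E') :
    ∃ D, IsCover (A ∪ B) (E + E') (A ∪ B).val D := by
  have hv : v ∈ A ∩ B := by simp [hAB]
  obtain ⟨q, q', p, p', R, h⟩ := h
  obtain ⟨q2, p2, R2, h'⟩ := h'.exists_concat_cons (Finset.mem_inter.1 hv).2 hu
  have H := h.add h'
  rw [add_assoc, val_add_val_of_inter hAB] at H
  have d1 : ∀ x ∈ q, x ∉ p2 := disjoint_of_inter_eq_singleton hAB
    (h.nodup _ (by simp)) (h.subset _ (by simp)) (h'.subset _ (by simp))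
  have d2 : ∀ x ∈ q2, x ∉ p := disjoint_of_inter_eq_singleton (Finset.inter_comm A B ▸ hAB)
    (h'.nodup _ (by simp)) (h'.subset _ (by simp)) (h.subset _ (by simp))
  refine ⟨_, IsCover.join (q := q2) (p := p) (v := v)
    (R := {q ++ v :: p2} + ({q' ++ [v]} + {v :: p'} + R + R2)) ?_ d2⟩
  have := IsCover.join (q := q) (p := p2) (v := v)
    (R := {q2 ++ [v]} + {v :: p} + ({q' ++ [v]} + {v :: p'} + R + R2)) (by convert H using 1; abel) d1
  convert this using 1
  abel

/-- Here `v` is a beginning four times. Three joins, each between an `A`-path and a `B`-path, leave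
one. -/
lemma HasDoubleCover.glue_double (hAB : A ∩ B = {v}) (h : HasDoubleCover A E v)
    (h' : HasDoubleCover B E' v) : ∃ D, IsCover (A ∪ B) (E + E') (A ∪ B).val D := by
  obtain ⟨q1, q1', p1, p1', R1, h⟩ := h
  obtain ⟨q2, q2', p2, p2', R2, h'⟩ := h'
  have H := h.add h'
  rw [add_assoc, add_left_comm A.val, val_add_val_of_inter hAB] at H
  have d1 : ∀ x ∈ q1, x ∉ p2 := disjoint_of_inter_eq_singleton hAB
    (h.nodup _ (by simp)) (h.subset _ (by simp)) (h'.subset _ (by simp))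
  have d1' : ∀ x ∈ q1', x ∉ p2' := disjoint_of_inter_eq_singleton hAB
    (h.nodup _ (by simp)) (h.subset _ (by simp)) (h'.subset _ (by simp))
  have d2 : ∀ x ∈ q2, x ∉ p1 := disjoint_of_inter_eq_singleton (Finset.inter_comm A B ▸ hAB)
    (h'.nodup _ (by simp)) (h'.subset _ (by simp)) (h.subset _ (by simp))
  have H1 := IsCover.join (q := q1) (p := p2) (v := v)
    (R := {q1' ++ [v]} + {v :: p2'} + {q2 ++ [v]} + {v :: p1} + {q2' ++ [v]} + {v :: p1'} + R1 + R2)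
    (by convert H using 1; abel) d1
  have H2 := IsCover.join (q := q1') (p := p2') (v := v)
    (R := {q1 ++ v :: p2} + {q2 ++ [v]} + {v :: p1} + {q2' ++ [v]} + {v :: p1'} + R1 + R2)
    (by convert H1 using 1; abel) d1'
  exact ⟨_, IsCover.join (q := q2) (p := p1) (v := v)
    (R := {q1 ++ v :: p2} + {q1' ++ v :: p2'} + {q2' ++ [v]} + {v :: p1'} + R1 + R2)
    (by convert H2 using 1; abel) d2⟩

end Glue

/-! ### Covers of cliques. -/

/-- The n paths have n(n - 1) arcs in all, so covering every arc forces covering it exactly once;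
the ends are counted likewise. -/
lemma HasPathDecomp.exists_isCover [Fintype α] [DecidableEq α] (h : HasPathDecomp α) :
    ∃ C, IsCover (Finset.univ : Finset α) (Finset.univ : Finset α).offDiag.val
      (Finset.univ : Finset α).val C := by
  obtain ⟨f, h1, h2, h3, h4, h5⟩ := h
  refine ⟨Finset.univ.val.map f, ?_, fun _ _ _ _ => Finset.mem_univ _, ?_, ?_, ?_⟩
  · intro l hl
    obtain ⟨i, -, rfl⟩ := Multiset.mem_map.1 hl
    exact h1 i
  · refine (Multiset.eq_of_le_of_card_le ((Multiset.le_iff_subset (Finset.nodup _)).2 ?_) ?_).symm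
    · rintro ⟨u, v⟩ huv
      obtain ⟨i, hi⟩ := h5 u v (Finset.mem_offDiag.1 huv).2.2
      exact Multiset.mem_bind.2 ⟨f i, Multiset.mem_map_of_mem _ (Finset.mem_univ i),
        Multiset.mem_coe.2 (mem_arcs_iff.2 hi)⟩
    · have hl : ∀ i, (f i).length = Fintype.card α := fun i => by
        rw [length_eq_card (h2 i) (h1 i), Nat.card_eq_fintype_card]
      rw [Multiset.card_bind, Finset.card_val, Finset.offDiag_card]
      simp [Function.comp_def, length_arcs, hl, Nat.mul_sub]
  · simp [h3]
  · refine (Multiset.eq_of_le_of_card_le ((Multiset.le_iff_subset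
      (Finset.univ.nodup.map (Option.some_injective α))).2 fun x hx => ?_) (by simp)).symm
    obtain ⟨v, -, rfl⟩ := Multiset.mem_map.1 hx
    obtain ⟨i, hi⟩ := h4 v
    rw [Multiset.map_map]
    exact Multiset.mem_map.2 ⟨i, Finset.mem_univ i, hi⟩

lemma exists_embedding (S : Finset α) {n : ℕ} (hS : S.card = n) :
    ∃ g : Fin n ↪ α, Finset.univ.map g = S := by
  subst hS
  refine ⟨S.equivFin.symm.toEmbedding.trans (Function.Embedding.subtype _), ?_⟩
  ext x
  simp only [Finset.mem_map, Finset.mem_univ, true_and]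
  constructor
  · rintro ⟨i, rfl⟩
    exact (S.equivFin.symm i).2
  · intro hx
    exact ⟨S.equivFin ⟨x, hx⟩, by simp⟩

lemma exists_embedding_zero {S : Finset α} {v : α} (hv : v ∈ S) {n : ℕ} [NeZero n]
    (hS : S.card = n) : ∃ g : Fin n ↪ α, Finset.univ.map g = S ∧ g 0 = v := by
  obtain ⟨g, rfl⟩ := exists_embedding S hS
  obtain ⟨i, -, rfl⟩ := Finset.mem_map.1 hv
  refine ⟨(Equiv.swap 0 i).toEmbedding.trans g, ?_, by simp⟩
  rw [← Finset.map_map]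
  simp

lemma offDiag_val_map [DecidableEq α] [DecidableEq β] (s : Finset α) (g : α ↪ β) :
    s.offDiag.val.map (Prod.map g g) = (s.map g).offDiag.val := by
  rw [show s.offDiag.val.map (Prod.map g g) = (s.offDiag.map (g.prodMap g)).val from rfl]
  congr 1
  ext ⟨x, y⟩
  simp only [Finset.mem_map, Finset.mem_offDiag, Prod.exists, Function.Embedding.coe_prodMap,
    Prod.map_apply, Prod.mk.injEq]
  constructor
  · rintro ⟨a, b, ⟨ha, hb, hab⟩, rfl, rfl⟩
    exact ⟨⟨a, ha, rfl⟩, ⟨b, hb, rfl⟩, g.injective.ne hab⟩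
  · rintro ⟨⟨a, ha, rfl⟩, ⟨b, hb, rfl⟩, hab⟩
    exact ⟨a, b, ⟨ha, hb, fun h => hab (by rw [h])⟩, rfl, rfl⟩

theorem exists_isCover_offDiag [DecidableEq α] (S : Finset α) (h3 : S.card ≠ 3)
    (h5 : S.card ≠ 5) : ∃ C, IsCover S S.offDiag.val S.val C := by
  obtain ⟨g, hg⟩ := exists_embedding S rfl
  obtain ⟨C, hC⟩ := (hasPathDecomp_fin _ h3 h5).exists_isCover
  have := hC.map g
  rw [offDiag_val_map, ← Finset.map_val, hg] at this
  exact ⟨_, this⟩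

lemma HasDoubleCover.map [DecidableEq α] [DecidableEq β] {A : Finset α} {v : α}
    (h : HasDoubleCover A A.offDiag.val v) (g : α ↪ β) :
    HasDoubleCover (A.map g) (A.map g).offDiag.val (g v) := by
  obtain ⟨q, q', p, p', R, h⟩ := h
  refine ⟨q.map g, q'.map g, p.map g, p'.map g, R.map (List.map g), ?_⟩
  have := h.map g
  rw [offDiag_val_map, Multiset.map_add, ← Finset.map_val] at this
  simpa using this

/-- Explicit families with distinguished vertex 0 suffice, as any vertex can be labelled 0. -/
theorem hasDoubleCover_offDiag [DecidableEq α] {S : Finset α} (h : S.card = 3 ∨ S.card = 5) {v : α}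
    (hv : v ∈ S) : HasDoubleCover S S.offDiag.val v := by
  rcases h with h | h
  · obtain ⟨g, rfl, rfl⟩ := exists_embedding_zero hv h
    refine HasDoubleCover.map ⟨[1], [2], [1, 2], [2, 1], 0, ?_⟩ g
    constructor <;> decide +kernel
  · obtain ⟨g, rfl, rfl⟩ := exists_embedding_zero hv h
    refine HasDoubleCover.map ⟨[1, 3, 4, 2], [2, 4, 3, 1], [2], [3, 2, 1, 4],
      {[3, 0, 4, 1]} + {[4, 0, 1, 2, 3]}, ?_⟩ g
    constructor <;> decide +kernel

/-! ### From list covers to an OPPDC. -/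

open SimpleGraph

section OPPDC

variable {α : Type*} {H : SimpleGraph α}

lemma arcs_support {u v : α} (p : H.Walk u v) : arcs p.support = p.darts.map (·.toProd) := by
  induction p with
  | nil => simp
  | cons h p ih =>
    cases p with
    | nil => simp
    | cons h' p => simpa using ih

lemma isChain_of_arcs {l : List α} (h : ∀ a ∈ arcs l, H.Adj a.1 a.2) : l.IsChain H.Adj := by
  induction l with
  | nil => simp
  | cons a l ih =>
    cases l with
    | nil => simp
    | cons b l =>
      rw [List.isChain_cons_cons]
      exact ⟨h (a, b) (by simp), ih fun x hx => h x (by simp [hx])⟩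

lemma mem_darts_iff {u v : α} (p : H.Walk u v) (d : H.Dart) :
    d ∈ p.darts ↔ d.toProd ∈ arcs p.support := by
  rw [arcs_support, List.mem_map]
  exact ⟨fun h => ⟨d, h, rfl⟩, fun ⟨d', h, e⟩ => SimpleGraph.Dart.ext d' d e ▸ h⟩

lemma directedPath_ext {P Q : H.DirectedPath} (h : P.walk.support = Q.walk.support) : P = Q := by
  obtain ⟨a, b, p, hp⟩ := P
  obtain ⟨c, d, q, hq⟩ := Q
  simp only at h
  obtain rfl : a = c := by
    have := congrArg List.head? h
    rw [List.head?_eq_some_head p.support_ne_nil, List.head?_eq_some_head q.support_ne_nil] at this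
    simpa using this
  obtain rfl : b = d := by
    have := congrArg List.getLast? h
    rw [List.getLast?_eq_some_getLast p.support_ne_nil,
      List.getLast?_eq_some_getLast q.support_ne_nil] at this
    simpa using this
  obtain rfl := Walk.ext_support h
  rfl

/-- A cover of all arcs of a graph by directed paths, as an oriented perfect path double cover. -/
theorem IsCover.hasOPPDC [Fintype α] {E : Multiset (α × α)} {C : Multiset (List α)}
    (h : IsCover Finset.univ E Finset.univ.val C) (hE : E.Nodup)
    (hH : ∀ a, a ∈ E ↔ H.Adj a.1 a.2) : H.HasOPPDC := by
  have hwalk : ∀ l ∈ C, ∃ P : H.DirectedPath, P.walk.support = l := by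
    intro l hl
    have hne : l ≠ [] := by
      rintro rfl
      have : none ∈ C.map List.head? := Multiset.mem_map.2 ⟨[], hl, rfl⟩
      rw [h.heads] at this
      simp at this
    have hch : l.IsChain H.Adj := isChain_of_arcs fun a ha => (hH a).1 (by
      rw [← h.bind_arcs]; exact Multiset.mem_bind.2 ⟨l, hl, ha⟩)
    have hs := Walk.support_ofSupport hne hch
    exact ⟨⟨_, _, Walk.ofSupport l hne hch, by
      rw [Walk.isPath_def, hs]; exact h.nodup l hl⟩, hs⟩
  have hstart : ∀ P : H.DirectedPath, P.walk.support.head? = some P.start := fun P => by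
    rw [List.head?_eq_some_head P.walk.support_ne_nil]; simp
  have hfinish : ∀ P : H.DirectedPath, P.walk.support.getLast? = some P.finish := fun P => by
    rw [List.getLast?_eq_some_getLast P.walk.support_ne_nil]; simp
  have hnd : (Finset.univ.val.map (some : α → Option α)).Nodup :=
    Finset.univ.nodup.map (Option.some_injective α)
  refine ⟨{P | P.walk.support ∈ C}, fun d => ?_, fun v => ?_, fun v => ?_⟩
  · have hd := (hH d.toProd).2 d.adj
    rw [← h.bind_arcs, Multiset.mem_bind] at hd
    obtain ⟨l, hl, hdl⟩ := hd
    obtain ⟨P, rfl⟩ := hwalk l hl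
    refine ⟨P, ⟨hl, (mem_darts_iff _ _).2 hdl⟩, fun Q ⟨hQ, hdQ⟩ => directedPath_ext ?_⟩
    rw [mem_darts_iff] at hdQ
    -- Two different members containing the arc would make it occur twice in `E`.
    by_contra hne
    obtain ⟨R, rfl⟩ := Multiset.exists_cons_of_mem hl
    obtain hQ | hQ := Multiset.mem_cons.1 hQ
    · exact hne hQ
    obtain ⟨R, rfl⟩ := Multiset.exists_cons_of_mem hQ
    rw [← h.bind_arcs, Multiset.cons_bind, Multiset.cons_bind] at hE
    have := Multiset.disjoint_left.1 (Multiset.nodup_add.1 hE).2.2 hdl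
    exact this (Multiset.mem_add.2 (Or.inl (Multiset.mem_coe.2 hdQ)))
  · obtain ⟨p, hp⟩ := h.exists_cons (Finset.mem_univ v)
    obtain ⟨P, hP⟩ := hwalk _ hp
    refine ⟨P, ⟨show P.walk.support ∈ C from hP ▸ hp, ?_⟩, fun Q ⟨hQ, hQv⟩ => directedPath_ext ?_⟩
    · have := hstart P
      rw [hP] at this
      simpa using this.symm
    · refine Multiset.inj_on_of_nodup_map (h.heads ▸ hnd) _ hQ _ (hP ▸ hp) ?_
      rw [hstart Q, hP, hQv]; rfl
  · obtain ⟨p, hp⟩ := h.exists_concat (Finset.mem_univ v)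
    obtain ⟨P, hP⟩ := hwalk _ hp
    refine ⟨P, ⟨show P.walk.support ∈ C from hP ▸ hp, ?_⟩, fun Q ⟨hQ, hQv⟩ => directedPath_ext ?_⟩
    · have := hfinish P
      rw [hP] at this
      simpa using this.symm
    · refine Multiset.inj_on_of_nodup_map (h.lasts ▸ hnd) _ hQ _ (hP ▸ hp) ?_
      rw [hfinish Q, hP, hQv]; simp

end OPPDC

/-! ### Growing a cover of the line graph along the tree. -/

section Tree

open Classical

variable {V : Type*} (T : SimpleGraph V)

/-- Any two vertices of `W` are joined by a walk inside `W`. -/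
def WalkConnected (W : Finset V) : Prop :=
  ∀ x ∈ W, ∀ y ∈ W, ∃ p : T.Walk x y, ∀ z ∈ p.support, z ∈ W

variable {T}

lemma eq_mk_of_mem {u w : V} (h : T.Adj u w) {e : T.edgeSet} (hu : u ∈ (e : Sym2 V))
    (hw : w ∈ (e : Sym2 V)) : e = ⟨s(u, w), h⟩ :=
  Subtype.ext ((Sym2.mem_and_mem_iff h.ne).1 ⟨hu, hw⟩)

lemma WalkConnected.singleton (w : V) : WalkConnected T {w} := by
  intro x hx y hy
  obtain rfl := Finset.mem_singleton.1 hx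
  obtain rfl := Finset.mem_singleton.1 hy
  exact ⟨Walk.nil, by simp⟩

lemma WalkConnected.insert {W : Finset V} (h : WalkConnected T W) {u w : V} (hu : u ∈ W)
    (huw : T.Adj u w) : WalkConnected T (insert w W) := by
  have key : ∀ x ∈ Insert.insert w W, ∃ p : T.Walk x u, ∀ z ∈ p.support, z ∈ Insert.insert w W := by
    intro x hx
    rcases Finset.mem_insert.1 hx with rfl | hx
    · exact ⟨Walk.cons huw.symm Walk.nil, by simp [hu]⟩
    · obtain ⟨p, hp⟩ := h x hx u hu
      exact ⟨p, fun z hz => Finset.mem_insert_of_mem (hp z hz)⟩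
  intro x hx y hy
  obtain ⟨p, hp⟩ := key x hx
  obtain ⟨q, hq⟩ := key y hy
  refine ⟨p.append q.reverse, fun z hz => ?_⟩
  rw [Walk.mem_support_append_iff, Walk.support_reverse, List.mem_reverse] at hz
  exact hz.elim (hp z) (hq z)

variable [Fintype V] (T)

/-- The edges of `T` at the vertex `w`. -/
noncomputable def starAt (w : V) : Finset T.edgeSet := Finset.univ.filter fun e => w ∈ (e : Sym2 V)

/-- The edges of `T` with an end in `W`. -/
noncomputable def edgesAt (W : Finset V) : Finset T.edgeSet := W.biUnion (starAt T)

/-- The arcs of the line graph whose two edges meet in a vertex of `W`. -/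
noncomputable def arcsAt (W : Finset V) : Multiset (T.edgeSet × T.edgeSet) :=
  ∑ w ∈ W, (starAt T w).offDiag.val

/-- The edges with an end in `W` have a cover which can be extended to neighbours of `W`. -/
structure Extendable (W : Finset V) : Prop where
  connected : WalkConnected T W
  exists_isCover : ∃ C, IsCover (edgesAt T W) (arcsAt T W) (edgesAt T W).val C
  entered : (∀ w, (starAt T w).card ≠ 3 ∧ (starAt T w).card ≠ 5) ∨
    ∀ e ∈ edgesAt T W, ∃ f, (f, e) ∈ arcsAt T W

variable {T}

@[simp] lemma mem_starAt {w : V} {e : T.edgeSet} : e ∈ starAt T w ↔ w ∈ (e : Sym2 V) := by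
  simp [starAt]

lemma mem_edgesAt {W : Finset V} {e : T.edgeSet} :
    e ∈ edgesAt T W ↔ ∃ w ∈ W, w ∈ (e : Sym2 V) := by
  simp [edgesAt]

@[simp] lemma edgesAt_singleton (w : V) : edgesAt T {w} = starAt T w := by simp [edgesAt]

@[simp] lemma arcsAt_singleton (w : V) : arcsAt T {w} = (starAt T w).offDiag.val := by simp [arcsAt]

lemma edgesAt_insert (W : Finset V) (w : V) : edgesAt T (insert w W) = starAt T w ∪ edgesAt T W := by
  simp [edgesAt]

lemma arcsAt_insert {W : Finset V} {w : V} (hw : w ∉ W) :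
    arcsAt T (insert w W) = (starAt T w).offDiag.val + arcsAt T W := by
  simp [arcsAt, hw]

lemma mem_arcsAt {W : Finset V} {a : T.edgeSet × T.edgeSet} :
    a ∈ arcsAt T W ↔ ∃ w ∈ W, a ∈ (starAt T w).offDiag := by
  simp only [arcsAt, Multiset.mem_sum, Finset.mem_val]

/-- A second neighbour x of `w` in `W` would give two paths from `u` to x: one inside `W`, the other
through `w`. -/
lemma starAt_inter_edgesAt (hT : T.IsAcyclic) {W : Finset V} (h : WalkConnected T W) {u w : V}
    (hu : u ∈ W) (hw : w ∉ W) (huw : T.Adj u w) :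
    starAt T w ∩ edgesAt T W = {⟨s(u, w), huw⟩} := by
  ext e
  rw [Finset.mem_inter, mem_starAt, mem_edgesAt, Finset.mem_singleton]
  constructor
  · rintro ⟨hwe, x, hx, hxe⟩
    have hxw : x ≠ w := fun h => hw (h ▸ hx)
    have hadj : T.Adj x w := by
      have := (Sym2.mem_and_mem_iff hxw).1 ⟨hxe, hwe⟩
      rw [← mem_edgeSet, ← this]; exact e.2
    by_cases hux : x = u
    · subst hux
      exact eq_mk_of_mem huw hxe hwe
    · exfalso
      obtain ⟨p, hp⟩ := h u hu x hx
      have hpath : (Walk.cons huw (Walk.cons hadj.symm Walk.nil)).IsPath := by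
        simp [Walk.isPath_def, huw.ne, hxw.symm, Ne.symm hux]
      have e := (hT.subsingleton_path u x).elim p.toPath ⟨_, hpath⟩
      have hmem : w ∈ (p.toPath : T.Walk u x).support := by rw [e]; simp
      exact hw (hp w (Walk.support_toPath_subset_support p hmem))
  · rintro rfl
    exact ⟨by simp, u, hu, by simp⟩

/-- New edges are entered from the linking edge, which was entered before. -/
lemma entered_insert {W : Finset V} {u w : V} (hu : u ∈ W) (hw : w ∉ W) (huw : T.Adj u w)
    (h : ∀ e ∈ edgesAt T W, ∃ f, (f, e) ∈ arcsAt T W) :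
    ∀ e ∈ edgesAt T (insert w W), ∃ f, (f, e) ∈ arcsAt T (insert w W) := by
  have hsub : ∀ e ∈ edgesAt T W, ∃ f, (f, e) ∈ arcsAt T (insert w W) := fun e he => by
    obtain ⟨f, hf⟩ := h e he
    exact ⟨f, by rw [arcsAt_insert hw]; exact Multiset.mem_add.2 (Or.inr hf)⟩
  have huE : (⟨s(u, w), huw⟩ : T.edgeSet) ∈ edgesAt T W := mem_edgesAt.2 ⟨u, hu, by simp⟩
  intro e he
  rw [edgesAt_insert, Finset.mem_union] at he
  rcases he with he | he
  · by_cases heq : e = ⟨s(u, w), huw⟩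
    · exact heq ▸ hsub _ huE
    · refine ⟨⟨s(u, w), huw⟩, mem_arcsAt.2 ⟨w, by simp, ?_⟩⟩
      rw [Finset.mem_offDiag]
      exact ⟨by simp, he, Ne.symm heq⟩
  · exact hsub e he

lemma Extendable.insert (hT : T.IsAcyclic) {W : Finset V} (h : Extendable T W) {u w : V}
    (hu : u ∈ W) (hw : w ∉ W) (huw : T.Adj u w) : Extendable T (insert w W) := by
  have hint := starAt_inter_edgesAt hT h.connected hu hw huw
  obtain ⟨C, hC⟩ := h.exists_isCover
  refine ⟨h.connected.insert hu huw, ?_, h.entered.imp_right (entered_insert hu hw huw)⟩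
  rw [edgesAt_insert, arcsAt_insert hw]
  by_cases hcard : (starAt T w).card = 3 ∨ (starAt T w).card = 5
  · have hent := h.entered.resolve_left fun H => hcard.elim (H w).1 (H w).2
    obtain ⟨f, hf⟩ := hent ⟨s(u, w), huw⟩ (mem_edgesAt.2 ⟨u, hu, by simp⟩)
    exact (hasDoubleCover_offDiag hcard (by simp)).glue hint hC hf
  · rw [not_or] at hcard
    obtain ⟨D, hD⟩ := exists_isCover_offDiag (starAt T w) hcard.1 hcard.2
    exact hD.glue hint hC

/-- A star of size 1 has no arcs, so it is a valid start only if no star of size 3 or 5 must be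
glued later. -/
lemma Extendable.singleton {w : V} (h3 : (starAt T w).card ≠ 3) (h5 : (starAt T w).card ≠ 5)
    (h : (∀ w, (starAt T w).card ≠ 3 ∧ (starAt T w).card ≠ 5) ∨ (starAt T w).card ≠ 1) :
    Extendable T {w} := by
  refine ⟨WalkConnected.singleton w, ?_, h.imp_right fun h1 e he => ?_⟩
  · simpa using exists_isCover_offDiag (starAt T w) h3 h5
  · rw [edgesAt_singleton] at he
    have := Finset.card_pos.2 ⟨e, he⟩
    obtain ⟨f, hf, hfe⟩ := Finset.exists_mem_ne (by omega : 1 < (starAt T w).card) e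
    exact ⟨f, by rw [arcsAt_singleton]; exact Finset.mem_offDiag.2 ⟨hf, he, hfe⟩⟩

lemma Extendable.pair (hT : T.IsAcyclic) {u w : V} (huw : T.Adj u w)
    (hu : (starAt T u).card = 3 ∨ (starAt T u).card = 5)
    (hw : (starAt T w).card = 3 ∨ (starAt T w).card = 5) : Extendable T {w, u} := by
  have hwu : w ∉ ({u} : Finset V) := by simpa using huw.ne'
  have hc : WalkConnected T {u} := .singleton u
  have hint := starAt_inter_edgesAt hT hc (by simp) hwu huw
  refine ⟨hc.insert (by simp) huw, ?_, Or.inr (entered_insert (by simp) hwu huw fun e he => ?_)⟩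
  · rw [edgesAt_insert, arcsAt_insert hwu]
    simp only [edgesAt_singleton, arcsAt_singleton] at hint ⊢
    exact (hasDoubleCover_offDiag hw (by simp)).glue_double hint
      (hasDoubleCover_offDiag hu (by simp))
  · rw [edgesAt_singleton] at he
    obtain ⟨f, hf, hfe⟩ := Finset.exists_mem_ne (by omega : 1 < (starAt T u).card) e
    exact ⟨f, by rw [arcsAt_singleton]; exact Finset.mem_offDiag.2 ⟨hf, he, hfe⟩⟩

/-- A walk from `W` to a missing vertex leaves `W` along an edge, which gives the next vertex to
add. -/
lemma Extendable.univ (hT : T.IsTree) {W : Finset V} (hW : W.Nonempty) (h : Extendable T W) :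
    Extendable T Finset.univ := by
  induction hn : (Finset.univ \ W).card generalizing W with
  | zero =>
    rw [Finset.card_eq_zero, Finset.sdiff_eq_empty_iff_subset, Finset.univ_subset_iff] at hn
    rwa [← hn]
  | succ n ih =>
    obtain ⟨y, hy⟩ : (Finset.univ \ W).Nonempty := Finset.card_pos.1 (by omega)
    obtain ⟨x, hx⟩ := hW
    obtain ⟨p⟩ := hT.connected.preconnected x y
    obtain ⟨d, -, hd1, hd2⟩ := p.exists_boundary_dart W hx (by simpa using hy)
    refine ih (by simp) (h.insert hT.isAcyclic hd1 hd2 d.adj) ?_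
    rw [Finset.sdiff_insert, Finset.card_erase_of_mem (by simpa using hd2), hn]
    rfl

/-- Two distinct edges share at most one vertex, so different stars have no arc in common. -/
lemma nodup_arcsAt (W : Finset V) : (arcsAt T W).Nodup := by
  induction W using Finset.induction_on with
  | empty => simp [arcsAt]
  | insert w W hw ih =>
    rw [arcsAt_insert hw, Multiset.nodup_add]
    refine ⟨Finset.nodup _, ih, Multiset.disjoint_left.2 fun {a} ha ha' => ?_⟩
    obtain ⟨x, hx, hax⟩ := mem_arcsAt.1 ha'
    rw [Finset.mem_val] at ha
    simp only [Finset.mem_offDiag, mem_starAt] at ha hax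
    have hxw : w ≠ x := fun h => hw (h ▸ hx)
    exact ha.2.2 (Subtype.ext (((Sym2.mem_and_mem_iff hxw).1 ⟨ha.1, hax.1⟩).trans
      ((Sym2.mem_and_mem_iff hxw).1 ⟨ha.2.1, hax.2.1⟩).symm))

lemma Extendable.hasOPPDC (h : Extendable T Finset.univ) : T.lineGraph.HasOPPDC := by
  obtain ⟨C, hC⟩ := h.exists_isCover
  have hE : edgesAt T Finset.univ = Finset.univ := by
    refine Finset.eq_univ_of_forall fun e => mem_edgesAt.2 ?_
    obtain ⟨⟨a, b⟩, he⟩ := e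
    exact ⟨a, Finset.mem_univ _, Sym2.mem_mk_left a b⟩
  rw [hE] at hC
  refine hC.hasOPPDC (nodup_arcsAt _) fun a => ?_
  rw [mem_arcsAt, lineGraph_adj_iff_exists]
  simp only [Finset.mem_univ, true_and, Finset.mem_offDiag, mem_starAt]
  tauto

/-- If all edges of `T` meet in one vertex, the line graph is complete. -/
lemma nonempty_iso_completeGraph {u : V} (h : ∀ e : T.edgeSet, u ∈ (e : Sym2 V)) {n : ℕ}
    (hn : (starAt T u).card = n) : Nonempty (T.lineGraph ≃g completeGraph (Fin n)) := by
  have hu : starAt T u = Finset.univ := Finset.eq_univ_of_forall fun e => mem_starAt.2 (h e)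
  rw [hu, Finset.card_univ] at hn
  refine ⟨⟨Fintype.equivFinOfCardEq hn, fun {a b} => ?_⟩⟩
  rw [lineGraph_adj_iff_exists]
  simp only [completeGraph, top_adj, ne_eq, EmbeddingLike.apply_eq_iff_eq]
  exact ⟨fun hab => ⟨hab, u, h a, h b⟩, fun hab => hab.1⟩

/-- If no vertex at distance one from `u` lies on a second edge, all edges meet in `u`. -/
lemma mem_of_forall_adj (hT : T.IsTree) {u : V} (h : ∀ w, T.Adj u w → (starAt T w).card = 1)
    (e : T.edgeSet) : u ∈ (e : Sym2 V) := by
  have key : ∀ {a : V}, T.Adj u a → ∀ e : T.edgeSet, a ∈ (e : Sym2 V) → e = s(u, a) := by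
    intro a ha e he
    obtain ⟨f, hf⟩ := Finset.card_eq_one.1 (h a ha)
    have h1 : e ∈ starAt T a := mem_starAt.2 he
    have h2 : (⟨s(u, a), ha⟩ : T.edgeSet) ∈ starAt T a := mem_starAt.2 (by simp)
    rw [hf, Finset.mem_singleton] at h1 h2
    rw [h1, ← h2]
  have hall : ∀ b, b = u ∨ T.Adj u b := by
    intro b
    by_contra hb
    obtain ⟨p⟩ := hT.connected.preconnected u b
    obtain ⟨d, -, hd1, hd2⟩ := p.exists_boundary_dart {b | b = u ∨ T.Adj u b} (Or.inl rfl) hb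
    rcases hd1 with hd1 | hd1
    · exact hd2 (Or.inr (hd1 ▸ d.adj))
    · have := key hd1 ⟨s(d.fst, d.snd), d.adj⟩ (by simp)
      have hmem : d.snd ∈ s(u, d.fst) := this ▸ Sym2.mem_mk_right _ _
      rcases Sym2.mem_iff.1 hmem with h | h
      · exact hd2 (Or.inl h)
      · exact d.adj.ne h.symm
  obtain ⟨a, ha⟩ : ∃ a, a ∈ (e : Sym2 V) := ⟨_, Sym2.out_fst_mem _⟩
  rcases hall a with rfl | hua
  · exact ha
  · rw [key hua e ha]; simp

end Tree

end PathCover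

/-! ### Choosing where to start. -/

open PathCover in
theorem mainTheorem12 {V : Type*} [Finite V] (T : SimpleGraph V) (hT : T.IsTree)
    (h3 : IsEmpty (T.lineGraph ≃g SimpleGraph.completeGraph (Fin 3)))
    (h5 : IsEmpty (T.lineGraph ≃g SimpleGraph.completeGraph (Fin 5))) :
    T.lineGraph.HasOPPDC := by
  have := Fintype.ofFinite V
  obtain ⟨w0⟩ := hT.connected.nonempty
  suffices h : ∃ W : Finset V, W.Nonempty ∧ Extendable T W by
    obtain ⟨W, hW, h⟩ := h
    exact (h.univ hT hW).hasOPPDC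
  by_cases hno : ∀ w, (starAt T w).card ≠ 3 ∧ (starAt T w).card ≠ 5
  · exact ⟨{w0}, by simp, .singleton (hno w0).1 (hno w0).2 (Or.inl hno)⟩
  by_cases hfree : ∃ w, (starAt T w).card ≠ 3 ∧ (starAt T w).card ≠ 5 ∧ (starAt T w).card ≠ 1
  · obtain ⟨w, hw3, hw5, hw1⟩ := hfree
    exact ⟨{w}, by simp, .singleton hw3 hw5 (Or.inr hw1)⟩
  -- From here on every star has size 1, 3 or 5.
  push Not at hno hfree
  obtain ⟨u, hu⟩ := hno
  replace hu : (starAt T u).card = 3 ∨ (starAt T u).card = 5 := or_iff_not_imp_left.2 hu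
  by_cases hnb : ∃ w, T.Adj u w ∧ (starAt T w).card ≠ 1
  · obtain ⟨w, huw, hw⟩ := hnb
    have hw' : (starAt T w).card = 3 ∨ (starAt T w).card = 5 := by
      by_contra hc
      rw [not_or] at hc
      exact hw (hfree w hc.1 hc.2)
    classical exact ⟨{w, u}, by simp, .pair hT.isAcyclic huw hu hw'⟩
  · push Not at hnb
    -- All neighbours of `u` are leaves, so `T` is a star with 3 or 5 edges.
    have hall := mem_of_forall_adj hT hnb
    rcases hu with hu | hu
    · exact (h3.false (nonempty_iso_completeGraph hall hu).some).elim
    · exact (h5.false (nonempty_iso_completeGraph hall hu).some).elim
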